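/- Let $\mathfrak g$ be the $N=1$ BMS superalgebra, i.e. the complex Lie superalgebra with even basis elements $L_n, M_n$ ($n\in\mathbb Z$), $\mathbf c_1,\mathbf c_2$, odd basis elements $Q_r$ ($r\in\mathbb Z+\frac12$), $\mathbf c_1,\mathbf c_2$ central, and $$[L_m,L_n]=(m-n)L_{m+n}+\tfrac1{12}\delta_{m+n,0}(m^3-m)\mathbf c_1,\qquad [L_m,M_n]=(m-n)M_{m+n}+\tfrac1{12}\delta_{m+n,0}(m^3-m)\mathbf c_2,$$ $$[Q_r,Q_s]=2M_{r+s}+\tfrac13\delta_{r+s,0}\left(r^2-\tfrac14\right)\mathbf c_2,\qquad [L_m,Q_r]=\left(\tfrac m2-r\right)Q_{m+r},\qquad [M_m,M_n]=[M_n,Q_r]=0 .$$ Modules over Lie superalgebras, their submodules and their isomorphisms are $\mathbb Z_2$-graded, and a simple module is a nonzero module with no submodules other than $0$ and itself. For $q\in\mathbb N=\{0,1,2,\dots\}$ let $\mathfrak g^{(0,-q)}$ be the subalgebra of $\mathfrak g$ spanned by $L_i$ ($i\ge 0$), $M_j$ ($j\ge -q$), $Q_{k-\frac12}$ ($k\ge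 1$), $\mathbf c_1$ and $\mathbf c_2$; for a $\mathfrak g^{(0,-q)}$-module $V$ put $\mathrm{Ind}_q(V)=U(\mathfrak g)\otimes_{U(\mathfrak g^{(0,-q)})}V$. A module has central charge $(c_1,c_2)$ if $\mathbf c_1,\mathbf c_2$ act on it as the scalars $c_1,c_2$. A $\mathfrak g$-module $W$ is smooth if for every $w\in W$ one has $L_iw=M_iw=Q_{i-\frac12}w=0$ for all sufficiently large $i$. The action of $x$ on $W$ is locally finite if for every $w\in W$ the span of $\{x^nw: n\in\mathbb N\}$ is finite-dimensional, and locally nilpotent if for every $w\in W$ there is $n\ge 1$ with $x^nw=0$. **Proposition.** Let $c_1,c_2\in\mathbb C$ and let $W$ be a simple smooth $\mathfrak g$-module of central charge $(c_1,c_2)$ such that $M_0+\frac1{24}(n^2-1)\mathbf c_2$ acts injectively on $W$ for every nonzero integer $n$. Then the following statements are equivalent: 1. There exists an integer $l\ge1$ such that the actions of $L_i$, $M_i$, $Q_{i-\frac12}$ on $W$ are locally finite for all $i\ge l$. 2. There exists an integer $l\ge1$ such that the actions of $L_i$, $M_i$, $Q_{i-\frac12}$ on $W$ are locally nilpotent for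 all $i\ge l$. 3. $W\cong\mathrm{Ind}_q(V)$ for some $q\in\mathbb N$ and some simple $\mathfrak g^{(0,-q)}$-module $V$ of central charge $(c_1,c_2)$ for which there exists $t\in\mathbb N$ such that - (a) if $t>0$, then $M_t$ acts injectively on $V$; if $t=0$, then $M_0+\frac1{24}(n^2-1)\mathbf c_2$ acts injectively on $V$ for every nonzero integer $n$; - (b) $M_iV=0$ for all $i>t$ and $L_jV=0$ for all $j>t+q$. -/

import Mathlib

open scoped TensorProduct

universe u

noncomputable section

/-! ## Super vector spaces, Lie superalgebras and their modules over the complex numbers -/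

/-- A `ℤ/2`-graded complex vector space `V = V₀ ⊕ V₁`; `part 0` is the even part and `part 1`
the odd part. -/
class SuperSpace (V : Type*) [AddCommGroup V] [Module ℂ V] where
  part : ZMod 2 → Submodule ℂ V
  isCompl : IsCompl (part 0) (part 1)

/-- The sign `(-1)^{ab}`. -/
def koszulSign (a b : ZMod 2) : ℂ := (-1) ^ (a.val * b.val)

theorem koszulSign_zero_left (b : ZMod 2) : koszulSign 0 b = 1 := by simp [koszulSign]

theorem koszulSign_zero_right (a : ZMod 2) : koszulSign a 0 = 1 := by simp [koszulSign]

/-- A complex Lie superalgebra: an even bilinear bracket that is super skew-symmetric and satisfies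
the super Jacobi identity. -/
class LieSuperalgebra (L : Type*) [AddCommGroup L] [Module ℂ L] extends SuperSpace L where
  sbracket : L →ₗ[ℂ] L →ₗ[ℂ] L
  sbracket_mem : ∀ (a b : ZMod 2) (x y : L), x ∈ part a → y ∈ part b →
    sbracket x y ∈ part (a + b)
  sbracket_skew : ∀ (a b : ZMod 2) (x y : L), x ∈ part a → y ∈ part b →
    sbracket x y = -(koszulSign a b • sbracket y x)
  sbracket_jacobi : ∀ (a b c : ZMod 2) (x y z : L), x ∈ part a → y ∈ part b → z ∈ part c →
    sbracket x (sbracket y z) =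
      sbracket (sbracket x y) z + koszulSign a b • sbracket y (sbracket x z)

open SuperSpace LieSuperalgebra

/-- A module over a Lie superalgebra `L`: a `ℤ/2`-graded vector space with an even linear action
`act` satisfying `[x, y] v = x (y v) - (-1)^{|x||y|} y (x v)`. -/
class LieSuperModule (L : Type*) [AddCommGroup L] [Module ℂ L] [LieSuperalgebra L]
    (V : Type*) [AddCommGroup V] [Module ℂ V] extends SuperSpace V where
  act : L →ₗ[ℂ] V →ₗ[ℂ] V
  act_mem : ∀ (a b : ZMod 2) (x : L) (v : V),
    x ∈ SuperSpace.part a → v ∈ part b → act x v ∈ part (a + b)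
  act_sbracket : ∀ (a b : ZMod 2) (x y : L), x ∈ SuperSpace.part a → y ∈ SuperSpace.part b →
    ∀ v : V, act (sbracket x y) v = act x (act y v) - koszulSign a b • act y (act x v)

open LieSuperModule

section Modules

variable (L : Type*) [AddCommGroup L] [Module ℂ L] [LieSuperalgebra L]
variable (V : Type*) [AddCommGroup V] [Module ℂ V] [LieSuperModule L V]
variable (W : Type*) [AddCommGroup W] [Module ℂ W] [LieSuperModule L W]

/-- A subspace `N` is a (graded) submodule if it is stable under the action and contains the even
and odd components of its elements. -/
structure IsSuperSubmodule (N : Submodule ℂ V) : Prop where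
  act_mem : ∀ (x : L) (v : V), v ∈ N → act x v ∈ N
  graded : ∀ v ∈ N, ∃ v₀ ∈ N, ∃ v₁ ∈ N, v₀ ∈ part 0 ∧ v₁ ∈ part 1 ∧ v = v₀ + v₁

/-- Simplicity in the category of (graded) modules. -/
structure IsSimpleSuperModule : Prop where
  nontrivial : Nontrivial V
  eq_bot_or_eq_top : ∀ N : Submodule ℂ V, IsSuperSubmodule L V N → N = ⊥ ∨ N = ⊤

/-- An isomorphism of modules: a bijective linear map that preserves the grading and commutes with
the action. -/
structure SuperModuleIso extends V ≃ₗ[ℂ] W where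
  map_part : ∀ (a : ZMod 2) (v : V), v ∈ part a → toLinearEquiv v ∈ part a
  map_act : ∀ (x : L) (v : V), toLinearEquiv (act x v) = act x (toLinearEquiv v)

end Modules

/-- The operator `f` is locally nilpotent. -/
def IsLocallyNilpotentOp {V : Type*} [AddCommGroup V] [Module ℂ V] (f : V →ₗ[ℂ] V) : Prop :=
  ∀ v : V, ∃ n : ℕ, 0 < n ∧ (f ^ n) v = 0

/-- The operator `f` is locally finite: the span of `v, f v, f² v, …` is finite-dimensional for
every `v`. -/
def IsLocallyFiniteOp {V : Type*} [AddCommGroup V] [Module ℂ V] (f : V →ₗ[ℂ] V) : Prop :=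
  ∀ v : V, FiniteDimensional ℂ (Submodule.span ℂ (Set.range fun n : ℕ => (f ^ n) v))

/-! ## Subalgebras -/

/-- A (graded) subalgebra of a Lie superalgebra. -/
structure LieSubSuperalgebra (L : Type*) [AddCommGroup L] [Module ℂ L] [LieSuperalgebra L]
    extends Submodule ℂ L where
  sbracket_mem : ∀ x y : L, x ∈ toSubmodule → y ∈ toSubmodule → sbracket x y ∈ toSubmodule
  graded : ∀ x ∈ toSubmodule, ∃ x₀ ∈ toSubmodule, ∃ x₁ ∈ toSubmodule,
    x₀ ∈ (part 0 : Submodule ℂ L) ∧ x₁ ∈ (part 1 : Submodule ℂ L) ∧ x = x₀ + x₁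

section Sub

variable {L : Type*} [AddCommGroup L] [Module ℂ L] [LieSuperalgebra L]

/-- The underlying Lie superalgebra of a subalgebra, with the restricted bracket and grading. -/
instance (H : LieSubSuperalgebra L) : LieSuperalgebra H.toSubmodule where
  part a := (part a : Submodule ℂ L).comap H.toSubmodule.subtype
  isCompl := by
    have hc := SuperSpace.isCompl (V := L)
    refine ⟨?_, ?_⟩
    · rw [Submodule.disjoint_def]
      intro x h0 h1
      exact Subtype.ext (Submodule.disjoint_def.1 hc.disjoint x.1 h0 h1)
    · rw [codisjoint_iff, eq_top_iff]
      rintro ⟨x, hx⟩ -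
      obtain ⟨x₀, h₀, x₁, h₁, e₀, e₁, rfl⟩ := H.graded x hx
      exact Submodule.mem_sup.2 ⟨⟨x₀, h₀⟩, e₀, ⟨x₁, h₁⟩, e₁, rfl⟩
  sbracket := LinearMap.mk₂ ℂ (fun x y => ⟨sbracket x.1 y.1, H.sbracket_mem _ _ x.2 y.2⟩)
    (fun x y z => Subtype.ext (by simp)) (fun c x y => Subtype.ext (by simp))
    (fun x y z => Subtype.ext (by simp)) (fun c x y => Subtype.ext (by simp))
  sbracket_mem a b x y hx hy := LieSuperalgebra.sbracket_mem a b x.1 y.1 hx hy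
  sbracket_skew a b x y hx hy := Subtype.ext (sbracket_skew a b x.1 y.1 hx hy)
  sbracket_jacobi a b c x y z hx hy hz :=
    Subtype.ext (sbracket_jacobi a b c x.1 y.1 z.1 hx hy hz)

end Sub

/-! ## The parity operator -/

section Parity

variable {V : Type*} [AddCommGroup V] [Module ℂ V]

/-- The parity operator: `v ↦ v` on the even part and `v ↦ -v` on the odd part. -/
def parity [SuperSpace V] : V →ₗ[ℂ] V :=
  (part 0 : Submodule ℂ V).projection (part 1) isCompl -
    (part 1 : Submodule ℂ V).projection (part 0) isCompl.symm

theorem parity_of_mem [SuperSpace V] {a : ZMod 2} {v : V} (hv : v ∈ part a) :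
    parity v = ((-1 : ℂ) ^ a.val) • v := by
  have key : ∀ b : ZMod 2, b = 0 ∨ b = 1 := by decide
  rcases key a with rfl | rfl
  · have h1 : (part 0 : Submodule ℂ V).projection (part 1) isCompl v = v :=
      Submodule.projection_apply_of_mem_left _ hv
    have h2 : (part 1 : Submodule ℂ V).projection (part 0) isCompl.symm v = 0 :=
      Submodule.projection_apply_of_mem_right _ hv
    simp [parity, h1, h2]
  · have h1 : (part 0 : Submodule ℂ V).projection (part 1) isCompl v = 0 :=
      Submodule.projection_apply_of_mem_right _ hv
    have h2 : (part 1 : Submodule ℂ V).projection (part 0) isCompl.symm v = v :=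
      Submodule.projection_apply_of_mem_left _ hv
    simp [parity, h1, h2, ZMod.val_one]

theorem neg_one_pow_val_add (a b : ZMod 2) :
    ((-1 : ℂ) ^ (a + b).val) = (-1) ^ a.val * (-1) ^ b.val := by
  rw [← pow_add, ZMod.val_add, ← neg_one_pow_eq_pow_mod_two]

theorem exists_eq_add_parts [SuperSpace V] (v : V) :
    ∃ v₀ ∈ (part 0 : Submodule ℂ V), ∃ v₁ ∈ (part 1 : Submodule ℂ V), v₀ + v₁ = v :=
  Submodule.mem_sup.1 (by rw [(SuperSpace.isCompl (V := V)).sup_eq_top]; trivial)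

theorem parity_parity [SuperSpace V] (v : V) : parity (parity v) = v := by
  obtain ⟨v₀, h₀, v₁, h₁, rfl⟩ := exists_eq_add_parts v
  simp [parity_of_mem h₀, parity_of_mem h₁, ZMod.val_one]

theorem mem_part_iff [SuperSpace V] {a : ZMod 2} {v : V} :
    v ∈ part a ↔ parity v = ((-1 : ℂ) ^ a.val) • v := by
  refine ⟨parity_of_mem, fun h => ?_⟩
  obtain ⟨v₀, h₀, v₁, h₁, rfl⟩ := exists_eq_add_parts v
  have key : ∀ b : ZMod 2, b = 0 ∨ b = 1 := by decide
  rcases key a with rfl | rfl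
  · simp only [map_add, parity_of_mem h₀, parity_of_mem h₁, ZMod.val_zero, ZMod.val_one, pow_zero,
      pow_one, one_smul, neg_smul] at h
    have : v₁ = 0 := by
      have h2 : (2 : ℂ) • v₁ = 0 := by
        rw [two_smul]; nth_rewrite 1 [← add_left_cancel h]; simp
      simpa using h2
    simpa [this] using h₀
  · simp only [map_add, parity_of_mem h₀, parity_of_mem h₁, ZMod.val_zero, ZMod.val_one, pow_zero,
      pow_one, one_smul, neg_smul] at h
    have : v₀ = 0 := by
      have h2 : (2 : ℂ) • v₀ = 0 := by
        rw [neg_add] at h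
        rw [two_smul]; nth_rewrite 1 [add_right_cancel h]; simp
      simpa using h2
    simpa [this] using h₁

theorem parity_act {L : Type*} [AddCommGroup L] [Module ℂ L] [LieSuperalgebra L]
    [LieSuperModule L V] (x : L) (v : V) :
    parity (act x v) = act (parity x) (parity v) := by
  have key (a b : ZMod 2) (x : L) (v : V) (hx : x ∈ part a) (hv : v ∈ part b) :
      parity (act x v) = act (parity x) (parity v) := by
    rw [parity_of_mem (LieSuperModule.act_mem a b x v hx hv), parity_of_mem hx, parity_of_mem hv,
      neg_one_pow_val_add]
    simp [smul_smul, mul_comm]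
  obtain ⟨x₀, hx₀, x₁, hx₁, rfl⟩ := exists_eq_add_parts x
  obtain ⟨v₀, hv₀, v₁, hv₁, rfl⟩ := exists_eq_add_parts v
  simp only [map_add, LinearMap.add_apply, key _ _ _ _ hx₀ hv₀, key _ _ _ _ hx₀ hv₁,
    key _ _ _ _ hx₁ hv₀, key _ _ _ _ hx₁ hv₁]

theorem parity_coe {L : Type*} [AddCommGroup L] [Module ℂ L] [LieSuperalgebra L]
    {H : LieSubSuperalgebra L} (x : H.toSubmodule) :
    ((parity x : H.toSubmodule) : L) = parity (x : L) := by
  obtain ⟨x₀, hx₀, x₁, hx₁, rfl⟩ := exists_eq_add_parts x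
  have h₀ : (x₀ : L) ∈ (part 0 : Submodule ℂ L) := hx₀
  have h₁ : (x₁ : L) ∈ (part 1 : Submodule ℂ L) := hx₁
  simp [parity_of_mem hx₀, parity_of_mem hx₁, parity_of_mem h₀, parity_of_mem h₁]

/-- The grading of a vector space given by an involution: `part a` is the eigenspace for
`(-1)^a`. -/
abbrev SuperSpace.ofInvolution (γ : V →ₗ[ℂ] V) (h : ∀ v, γ (γ v) = v) : SuperSpace V where
  part a := LinearMap.ker (γ - ((-1 : ℂ) ^ a.val) • LinearMap.id)
  isCompl := by
    refine ⟨?_, ?_⟩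
    · rw [Submodule.disjoint_def]
      intro v h0 h1
      simp only [ZMod.val_zero, ZMod.val_one, pow_zero, pow_one, LinearMap.mem_ker,
        LinearMap.sub_apply, LinearMap.id_apply, one_smul, neg_smul,
        sub_neg_eq_add, sub_eq_zero, LinearMap.add_apply] at h0 h1
      rw [h0, ← two_smul ℂ] at h1
      simpa using h1
    · rw [codisjoint_iff, eq_top_iff]
      intro v _
      refine Submodule.mem_sup.2
        ⟨(1 / 2 : ℂ) • (v + γ v), ?_, (1 / 2 : ℂ) • (v - γ v), ?_, ?_⟩
      · simp [h, add_comm]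
      · simp [h, ZMod.val_one]
      · module

end Parity

/-! ## Enveloping algebra and induced modules -/

section Enveloping

variable (L : Type*) [AddCommGroup L] [Module ℂ L] [LieSuperalgebra L]

/-- The defining relations `x y - (-1)^{|x||y|} y x = [x, y]` of the enveloping algebra. -/
inductive SuperEnveloping.Rel : TensorAlgebra ℂ L → TensorAlgebra ℂ L → Prop
  | mk (a b : ZMod 2) (x y : L) (hx : x ∈ (part a : Submodule ℂ L))
      (hy : y ∈ (part b : Submodule ℂ L)) :
      Rel (TensorAlgebra.ι ℂ x * TensorAlgebra.ι ℂ y -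
          koszulSign a b • (TensorAlgebra.ι ℂ y * TensorAlgebra.ι ℂ x))
        (TensorAlgebra.ι ℂ (sbracket x y))

/-- The universal enveloping algebra `U(L)` of a Lie superalgebra. -/
def SuperEnveloping : Type _ := RingQuot (SuperEnveloping.Rel L)

instance : Ring (SuperEnveloping L) := inferInstanceAs (Ring (RingQuot _))
instance : Algebra ℂ (SuperEnveloping L) := inferInstanceAs (Algebra ℂ (RingQuot _))

/-- The quotient map from the tensor algebra. -/
def SuperEnveloping.mkAlgHom : TensorAlgebra ℂ L →ₐ[ℂ] SuperEnveloping L :=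
  RingQuot.mkAlgHom ℂ (SuperEnveloping.Rel L)

variable {L}

/-- The canonical map `L → U(L)`. -/
def SuperEnveloping.ι : L →ₗ[ℂ] SuperEnveloping L :=
  (SuperEnveloping.mkAlgHom L).toLinearMap ∘ₗ TensorAlgebra.ι ℂ

theorem SuperEnveloping.ι_sbracket (a b : ZMod 2) (x y : L) (hx : x ∈ (part a : Submodule ℂ L))
    (hy : y ∈ (part b : Submodule ℂ L)) :
    SuperEnveloping.ι (sbracket x y) =
      SuperEnveloping.ι x * SuperEnveloping.ι y -
        koszulSign a b • (SuperEnveloping.ι y * SuperEnveloping.ι x) := by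
  have h := RingQuot.mkAlgHom_rel ℂ (SuperEnveloping.Rel.mk a b x y hx hy)
  change SuperEnveloping.mkAlgHom L _ = SuperEnveloping.mkAlgHom L _ at h
  simp only [map_sub, map_mul, map_smul] at h
  exact h.symm

theorem SuperEnveloping.parityHom_rel ⦃s t : TensorAlgebra ℂ L⦄ (h : SuperEnveloping.Rel L s t) :
    TensorAlgebra.lift ℂ ((SuperEnveloping.ι (L := L)) ∘ₗ parity) s =
      TensorAlgebra.lift ℂ (SuperEnveloping.ι ∘ₗ parity) t := by
  obtain ⟨a, b, x, y, hx, hy⟩ := h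
  have hxy := parity_of_mem (LieSuperalgebra.sbracket_mem a b x y hx hy)
  simp only [map_sub, map_mul, map_smul, TensorAlgebra.lift_ι_apply, LinearMap.comp_apply,
    parity_of_mem hx, parity_of_mem hy, hxy, neg_one_pow_val_add, SuperEnveloping.ι_sbracket a b x y hx hy,
    smul_mul_smul_comm, smul_sub, smul_smul]
  congr 2
  ring

/-- The algebra automorphism of `U(L)` extending the parity operator of `L`; it is `(-1)^a` on
the component of parity `a` of `U(L)`. -/
def SuperEnveloping.parityHom : SuperEnveloping L →ₐ[ℂ] SuperEnveloping L :=
  RingQuot.liftAlgHom ℂ ⟨TensorAlgebra.lift ℂ (SuperEnveloping.ι ∘ₗ parity),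
    SuperEnveloping.parityHom_rel⟩

theorem SuperEnveloping.parityHom_ι (x : L) :
    SuperEnveloping.parityHom (SuperEnveloping.ι x) = SuperEnveloping.ι (parity x) := by
  have h := RingQuot.liftAlgHom_mkAlgHom_apply ℂ
    (TensorAlgebra.lift ℂ ((SuperEnveloping.ι (L := L)) ∘ₗ parity))
    (SuperEnveloping.parityHom_rel (L := L)) (TensorAlgebra.ι ℂ x)
  rw [TensorAlgebra.lift_ι_apply] at h
  exact h

theorem SuperEnveloping.parityHom_parityHom (z : SuperEnveloping L) :
    SuperEnveloping.parityHom (SuperEnveloping.parityHom z) = z := by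
  have h : (SuperEnveloping.parityHom (L := L)).comp SuperEnveloping.parityHom =
      AlgHom.id ℂ (SuperEnveloping L) := by
    refine RingQuot.ringQuot_ext' ℂ _ _ (TensorAlgebra.hom_ext ?_)
    ext x
    change SuperEnveloping.parityHom (SuperEnveloping.parityHom (SuperEnveloping.ι x)) =
      SuperEnveloping.ι x
    rw [SuperEnveloping.parityHom_ι, SuperEnveloping.parityHom_ι, parity_parity]
  exact DFunLike.congr_fun h z

variable (H : LieSubSuperalgebra L)
variable (V : Type*) [AddCommGroup V] [Module ℂ V] [LieSuperModule H.toSubmodule V]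

/-- The `U(L)`-submodule of `U(L) ⊗ V` generated by the elements `h ⊗ v - 1 ⊗ h v` with `h ∈ H`,
that is, the span of all `u h ⊗ v - u ⊗ h v`. -/
def indRel : Submodule (SuperEnveloping L) (SuperEnveloping L ⊗[ℂ] V) :=
  Submodule.span (SuperEnveloping L)
    {z | ∃ (h : H.toSubmodule) (v : V),
      z = SuperEnveloping.ι (h : L) ⊗ₜ[ℂ] v - 1 ⊗ₜ[ℂ] (act h v)}

/-- The induced module `U(L) ⊗_{U(H)} V`, as the quotient of `U(L) ⊗_ℂ V` by the relations
`u h ⊗ v = u ⊗ h v` for `h ∈ H` (as `H` generates `U(H)`, these are all the relations of the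
tensor product over `U(H)`). -/
def Ind : Type _ := (SuperEnveloping L ⊗[ℂ] V) ⧸ indRel H V

namespace Ind

instance : AddCommGroup (Ind H V) := inferInstanceAs (AddCommGroup (_ ⧸ indRel H V))
instance : Module (SuperEnveloping L) (Ind H V) :=
  inferInstanceAs (Module (SuperEnveloping L) (_ ⧸ indRel H V))
instance : Module ℂ (Ind H V) := inferInstanceAs (Module ℂ (_ ⧸ indRel H V))
instance : IsScalarTower ℂ (SuperEnveloping L) (Ind H V) :=
  inferInstanceAs (IsScalarTower ℂ (SuperEnveloping L) (_ ⧸ indRel H V))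

/-- The class of a tensor. -/
def mk : SuperEnveloping L ⊗[ℂ] V →ₗ[ℂ] Ind H V := (indRel H V).mkQ.restrictScalars ℂ

theorem mk_surjective : Function.Surjective (mk H V) := (indRel H V).mkQ_surjective

theorem mk_smul (w : SuperEnveloping L) (z : SuperEnveloping L ⊗[ℂ] V) :
    mk H V (w • z) = w • mk H V z := rfl

/-- The parity operator `u ⊗ v ↦ (-1)^{|u| + |v|} u ⊗ v` of the induced module. -/
def parityOp : Ind H V →ₗ[ℂ] Ind H V :=
  ((indRel H V).restrictScalars ℂ).mapQ ((indRel H V).restrictScalars ℂ)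
    (TensorProduct.map SuperEnveloping.parityHom.toLinearMap parity) (by
      intro z hz
      rw [Submodule.restrictScalars_mem] at hz
      rw [Submodule.mem_comap, Submodule.restrictScalars_mem]
      induction hz using Submodule.span_induction with
      | mem z hz =>
        obtain ⟨h, v, rfl⟩ := hz
        have hv : parity (act h v) = act (parity h) (parity v) := parity_act h v
        rw [map_sub, TensorProduct.map_tmul, TensorProduct.map_tmul, hv]
        refine Submodule.subset_span ⟨parity h, parity v, ?_⟩
        simp [SuperEnveloping.parityHom_ι, parity_coe]
      | zero => simp
      | add x y _ _ hx hy => rw [map_add]; exact Submodule.add_mem _ hx hy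
      | smul w z _ hz =>
        have : TensorProduct.map SuperEnveloping.parityHom.toLinearMap parity (w • z) =
            SuperEnveloping.parityHom w •
              TensorProduct.map (SuperEnveloping.parityHom (L := L)).toLinearMap
                (parity (V := V)) z := by
          clear * -
          induction z using TensorProduct.induction_on with
          | zero => simp
          | tmul x y => simp [TensorProduct.smul_tmul']
          | add x y hx hy => rw [smul_add, map_add, hx, hy, map_add, smul_add]
        rw [this]
        exact Submodule.smul_mem _ _ hz)

theorem parityOp_mk (w : SuperEnveloping L) (v : V) :
    parityOp H V (mk H V (w ⊗ₜ v)) = mk H V (SuperEnveloping.parityHom w ⊗ₜ parity v) := rfl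

theorem parityOp_parityOp (z : Ind H V) : parityOp H V (parityOp H V z) = z := by
  obtain ⟨z, rfl⟩ := mk_surjective H V z
  induction z using TensorProduct.induction_on with
  | zero => simp
  | tmul x y =>
    rw [parityOp_mk, parityOp_mk, SuperEnveloping.parityHom_parityHom, parity_parity]
  | add x y hx hy => simp only [map_add, hx, hy]

theorem parityOp_smul (w : SuperEnveloping L) (z : Ind H V) :
    parityOp H V (w • z) = SuperEnveloping.parityHom w • parityOp H V z := by
  obtain ⟨z, rfl⟩ := mk_surjective H V z
  induction z using TensorProduct.induction_on with
  | zero => simp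
  | tmul x y =>
    rw [← mk_smul, TensorProduct.smul_tmul', parityOp_mk, parityOp_mk, ← mk_smul,
      TensorProduct.smul_tmul', smul_eq_mul, smul_eq_mul, map_mul]
  | add x y hx hy => rw [map_add, smul_add, map_add, hx, hy, map_add, smul_add]

/-- The `L`-module structure of the induced module: `x (u ⊗ v) = (x u) ⊗ v`, and `u ⊗ v` has
parity `|u| + |v|`. -/
instance : LieSuperModule L (Ind H V) where
  toSuperSpace := SuperSpace.ofInvolution (parityOp H V) (parityOp_parityOp H V)
  act := (Algebra.lsmul ℂ ℂ (Ind H V)).toLinearMap ∘ₗ SuperEnveloping.ι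
  act_mem a b x z hx hz := by
    have hz : parityOp H V z = ((-1 : ℂ) ^ b.val) • z := sub_eq_zero.1 hz
    refine sub_eq_zero.2 ?_
    change parityOp H V (SuperEnveloping.ι x • z) =
      ((-1 : ℂ) ^ (a + b).val) • SuperEnveloping.ι x • z
    rw [ parityOp_smul, hz, SuperEnveloping.parityHom_ι, parity_of_mem hx,
      neg_one_pow_val_add]
    rw [map_smul, smul_assoc, smul_comm (SuperEnveloping.ι x), smul_smul]
  act_sbracket a b x y hx hy z := by
    change SuperEnveloping.ι (sbracket x y) • z =
      SuperEnveloping.ι x • SuperEnveloping.ι y • z -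
        koszulSign a b • SuperEnveloping.ι y • SuperEnveloping.ι x • z
    rw [SuperEnveloping.ι_sbracket a b x y hx hy, sub_smul, mul_smul, smul_assoc, mul_smul]

end Ind

end Enveloping

/-! ## The `N = 1` BMS superalgebra -/

/-- Labels of the basis of the `N = 1` BMS superalgebra. The odd element with label `Q n` is
`Q_{n - 1/2}`. -/
inductive BMSIndex
  | L (n : ℤ)
  | M (n : ℤ)
  | Q (n : ℤ)
  | c₁
  | c₂

/-- The underlying vector space of the `N = 1` BMS superalgebra, with basis indexed by
`BMSIndex`. -/
def BMS : Type := BMSIndex →₀ ℂ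

namespace BMS

instance : AddCommGroup BMS := inferInstanceAs (AddCommGroup (BMSIndex →₀ ℂ))
instance : Module ℂ BMS := inferInstanceAs (Module ℂ (BMSIndex →₀ ℂ))

/-- The defining basis. -/
def basis : Module.Basis BMSIndex ℂ BMS :=
  .ofRepr (LinearEquiv.refl ℂ (BMSIndex →₀ ℂ))

theorem basis_apply (i : BMSIndex) : basis i = (Finsupp.single i 1 : BMSIndex →₀ ℂ) := rfl

/-- `L_n`. -/
def L (n : ℤ) : BMS := basis (.L n)
/-- `M_n`. -/
def M (n : ℤ) : BMS := basis (.M n)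
/-- `Q_{n - 1/2}`. -/
def Q (n : ℤ) : BMS := basis (.Q n)
/-- The first central element. -/
def c₁ : BMS := basis .c₁
/-- The second central element. -/
def c₂ : BMS := basis .c₂

/-- The parity of a basis element. -/
def parityIndex : BMSIndex → ZMod 2
  | .Q _ => 1
  | _ => 0

/-- The bracket of two basis elements. With `r = m - 1/2` and `s = n - 1/2`, the bracket of
`Q_r` and `Q_s` is `2 M_{r+s} + (1/3) δ_{r+s,0} (r² - 1/4) c₂`, and the bracket of `L_m` and `Q_s`
is `(m/2 - s) Q_{m+s}`. -/
def bracketBasis : BMSIndex → BMSIndex → BMS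
  | .L m, .L n => ((m : ℂ) - n) • L (m + n) +
      (if m + n = 0 then (1 / 12 : ℂ) * ((m : ℂ) ^ 3 - m) else 0) • c₁
  | .L m, .M n => ((m : ℂ) - n) • M (m + n) +
      (if m + n = 0 then (1 / 12 : ℂ) * ((m : ℂ) ^ 3 - m) else 0) • c₂
  | .M m, .L n => -(((n : ℂ) - m) • M (n + m) +
      (if n + m = 0 then (1 / 12 : ℂ) * ((n : ℂ) ^ 3 - n) else 0) • c₂)
  | .Q m, .Q n => (2 : ℂ) • M (m + n - 1) +
      (if m + n - 1 = 0 then (1 / 3 : ℂ) * (((m : ℂ) - 1 / 2) ^ 2 - 1 / 4) else 0) • c₂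
  | .L m, .Q n => ((m : ℂ) / 2 - ((n : ℂ) - 1 / 2)) • Q (m + n)
  | .Q m, .L n => -(((n : ℂ) / 2 - ((m : ℂ) - 1 / 2)) • Q (n + m))
  | _, _ => 0

/-- The bilinear extension of `bracketBasis`. -/
def bracket : BMS →ₗ[ℂ] BMS →ₗ[ℂ] BMS :=
  basis.constr ℂ fun i => basis.constr ℂ fun j => bracketBasis i j

theorem bracket_basis (i j : BMSIndex) :
    bracket (basis i) (basis j) = bracketBasis i j := by
  rw [bracket, Module.Basis.constr_basis, Module.Basis.constr_basis]

/-- The grading: `part a` is spanned by the basis elements of parity `a`. -/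
instance : SuperSpace BMS where
  part a := Submodule.span ℂ (basis '' {i | parityIndex i = a})
  isCompl := by
    have key : ∀ b : ZMod 2, b = 0 ∨ b = 1 := by decide
    have hs (a : ZMod 2) : Submodule.span ℂ (basis '' {i | parityIndex i = a}) =
        Finsupp.supported ℂ ℂ {i | parityIndex i = a} :=
      (Finsupp.supported_eq_span_single ℂ _).symm
    rw [hs, hs]
    refine ⟨Finsupp.disjoint_supported_supported ?_, Finsupp.codisjoint_supported_supported ?_⟩
    · rw [Set.disjoint_left]
      intro i h0 h1
      simp only [Set.mem_ofPred_eq] at h0 h1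
      rw [h0] at h1
      exact absurd h1 (by decide)
    · rw [codisjoint_iff, eq_top_iff]
      exact fun i _ => key (parityIndex i)

theorem single_mem_part (i : BMSIndex) :
    basis i ∈ (part (parityIndex i) : Submodule ℂ BMS) :=
  Submodule.subset_span ⟨i, rfl, rfl⟩

theorem bracketBasis_mem (i j : BMSIndex) :
    bracketBasis i j ∈ (part (parityIndex i + parityIndex j) : Submodule ℂ BMS) := by
  have hL (n : ℤ) : L n ∈ (part 0 : Submodule ℂ BMS) := single_mem_part (.L n)
  have hM (n : ℤ) : M n ∈ (part 0 : Submodule ℂ BMS) := single_mem_part (.M n)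
  have hQ (n : ℤ) : Q n ∈ (part 1 : Submodule ℂ BMS) := single_mem_part (.Q n)
  have h1 : c₁ ∈ (part 0 : Submodule ℂ BMS) := single_mem_part .c₁
  have h2 : c₂ ∈ (part 0 : Submodule ℂ BMS) := single_mem_part .c₂
  have h11 : (1 + 1 : ZMod 2) = 0 := by decide
  cases i <;> cases j <;> simp only [bracketBasis, parityIndex, add_zero, zero_add, h11] <;>
    first
      | exact Submodule.zero_mem _
      | exact Submodule.add_mem _ (Submodule.smul_mem _ _ (hL _)) (Submodule.smul_mem _ _ h1)
      | exact Submodule.add_mem _ (Submodule.smul_mem _ _ (hM _)) (Submodule.smul_mem _ _ h2)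
      | exact Submodule.neg_mem _
          (Submodule.add_mem _ (Submodule.smul_mem _ _ (hM _)) (Submodule.smul_mem _ _ h2))
      | exact Submodule.smul_mem _ _ (hQ _)
      | exact Submodule.neg_mem _ (Submodule.smul_mem _ _ (hQ _))

theorem bracketBasis_skew (i j : BMSIndex) :
    bracketBasis i j = -(koszulSign (parityIndex i) (parityIndex j) • bracketBasis j i) := by
  have h : koszulSign 1 1 = -1 := by simp [koszulSign, ZMod.val_one]
  cases i <;> cases j <;>
    simp only [bracketBasis, parityIndex, koszulSign_zero_left, koszulSign_zero_right, h, one_smul,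
      neg_neg, smul_zero, neg_zero, neg_smul]
  case L.L m n =>
    rw [add_comm n m]
    split_ifs with h0
    · obtain rfl : n = -m := by omega
      push_cast
      module
    · module
  case Q.Q m n =>
    rw [add_comm n m]
    split_ifs with h0
    · obtain rfl : n = 1 - m := by omega
      push_cast
      module
    · module

theorem bracketBasis_jacobi (i j k : BMSIndex) :
    bracket (basis i) (bracketBasis j k) =
      bracket (bracketBasis i j) (basis k) +
        koszulSign (parityIndex i) (parityIndex j) •
          bracket (basis j) (bracketBasis i k) := by
  have h : koszulSign 1 1 = -1 := by simp [koszulSign, ZMod.val_one]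
  cases i <;> cases j <;> cases k <;>
    simp only [bracketBasis, parityIndex, koszulSign_zero_left, koszulSign_zero_right, h, one_smul,
      map_add, map_smul, map_neg, map_zero, LinearMap.add_apply, LinearMap.smul_apply,
      LinearMap.neg_apply, LinearMap.zero_apply, L, M, Q, c₁, c₂, bracket_basis, smul_zero,
      add_zero, neg_zero]
  case L.L.L m n p =>
    simp only [show m + (n + p) = m + n + p by ring,
      show n + (m + p) = m + n + p by ring]
    by_cases h0 : m + n + p = 0
    · obtain rfl : p = -m - n := by omega
      simp only [if_pos h0]
      push_cast
      module
    · simp only [if_neg h0]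
      push_cast
      module
  case L.L.M m n p =>
    simp only [show m + (n + p) = m + n + p by ring,
      show n + (m + p) = m + n + p by ring]
    by_cases h0 : m + n + p = 0
    · obtain rfl : p = -m - n := by omega
      simp only [if_pos h0]
      push_cast
      module
    · simp only [if_neg h0]
      push_cast
      module
  case L.L.Q m n p =>
    simp only [show m + (n + p) = m + n + p by ring,
      show n + (m + p) = m + n + p by ring]
    push_cast
    module
  case L.M.L m n p =>
    simp only [show m + (p + n) = m + n + p by ring,
      show p + (m + n) = m + n + p by ring,
      show m + p + n = m + n + p by ring]
    by_cases h0 : m + n + p = 0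
    · obtain rfl : p = -m - n := by omega
      simp only [if_pos h0]
      push_cast
      module
    · simp only [if_neg h0]
      push_cast
      module
  case L.Q.L m n p =>
    simp only [show m + (p + n) = m + n + p by ring,
      show p + (m + n) = m + n + p by ring,
      show m + p + n = m + n + p by ring]
    push_cast
    module
  case L.Q.Q m n p =>
    simp only [show m + (n + p - 1) = m + n + p - 1 by ring,
      show n + (m + p) - 1 = m + n + p - 1 by ring]
    by_cases h0 : m + n + p - 1 = 0
    · obtain rfl : p = 1 -m - n := by omega
      simp only [if_pos h0]
      push_cast
      module
    · simp only [if_neg h0]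
      push_cast
      module
  case M.L.L m n p =>
    simp only [show n + p + m = m + n + p by ring,
      show p + (n + m) = m + n + p by ring,
      show n + (p + m) = m + n + p by ring]
    by_cases h0 : m + n + p = 0
    · obtain rfl : p = -m - n := by omega
      simp only [if_pos h0]
      push_cast
      module
    · simp only [if_neg h0]
      push_cast
      module
  case Q.L.L m n p =>
    simp only [show n + p + m = m + n + p by ring,
      show p + (n + m) = m + n + p by ring,
      show n + (p + m) = m + n + p by ring]
    push_cast
    module
  case Q.L.Q m n p =>
    simp only [show m + (n + p) - 1 = m + n + p - 1 by ring,
      show n + m + p - 1 = m + n + p - 1 by ring,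
      show n + (m + p - 1) = m + n + p - 1 by ring]
    by_cases h0 : m + n + p - 1 = 0
    · obtain rfl : p = 1 -m - n := by omega
      simp only [if_pos h0]
      push_cast
      module
    · simp only [if_neg h0]
      push_cast
      module
  case Q.Q.L m n p =>
    simp only [show m + (p + n) - 1 = m + n + p - 1 by ring,
      show p + (m + n - 1) = m + n + p - 1 by ring,
      show n + (p + m) - 1 = m + n + p - 1 by ring]
    by_cases h0 : m + n + p - 1 = 0
    · obtain rfl : p = 1 -m - n := by omega
      simp only [if_pos h0]
      push_cast
      module
    · simp only [if_neg h0]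
      push_cast
      module

instance : LieSuperalgebra BMS where
  sbracket := bracket
  sbracket_mem a b x y hx hy := by
    induction hx using Submodule.span_induction with
    | zero => simp
    | add x x' _ _ h h' => rw [map_add, LinearMap.add_apply]; exact Submodule.add_mem _ h h'
    | smul r x _ h => rw [map_smul, LinearMap.smul_apply]; exact Submodule.smul_mem _ r h
    | mem x hx =>
      obtain ⟨i, rfl, rfl⟩ := hx
      induction hy using Submodule.span_induction with
      | zero => simp
      | add x x' _ _ h h' => rw [map_add]; exact Submodule.add_mem _ h h'
      | smul r x _ h => rw [map_smul]; exact Submodule.smul_mem _ r h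
      | mem y hy =>
        obtain ⟨j, rfl, rfl⟩ := hy
        rw [bracket_basis]
        exact bracketBasis_mem i j
  sbracket_skew a b x y hx hy := by
    induction hx using Submodule.span_induction with
    | zero => simp
    | add x x' _ _ h h' => simp only [map_add, LinearMap.add_apply, h, h']; module
    | smul r x _ h => simp only [map_smul, LinearMap.smul_apply, h]; module
    | mem x hx =>
      obtain ⟨i, rfl, rfl⟩ := hx
      induction hy using Submodule.span_induction with
      | zero => simp
      | add x x' _ _ h h' => simp only [map_add, LinearMap.add_apply, h, h']; module
      | smul r x _ h => simp only [map_smul, LinearMap.smul_apply, h]; module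
      | mem y hy =>
        obtain ⟨j, rfl, rfl⟩ := hy
        rw [bracket_basis, bracket_basis]
        exact bracketBasis_skew i j
  sbracket_jacobi a b c x y z hx hy hz := by
    induction hx using Submodule.span_induction with
    | zero => simp
    | add x x' _ _ h h' => simp only [map_add, LinearMap.add_apply, h, h']; module
    | smul r x _ h => simp only [map_smul, LinearMap.smul_apply, h]; module
    | mem x hx =>
      obtain ⟨i, rfl, rfl⟩ := hx
      induction hy using Submodule.span_induction with
      | zero => simp
      | add x x' _ _ h h' => simp only [map_add, LinearMap.add_apply, h, h']; module
      | smul r x _ h => simp only [map_smul, LinearMap.smul_apply, h]; module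
      | mem y hy =>
        obtain ⟨j, rfl, rfl⟩ := hy
        induction hz using Submodule.span_induction with
        | zero => simp
        | add x x' _ _ h h' => simp only [map_add, h, h']; module
        | smul r x _ h => simp only [map_smul, h]; module
        | mem z hz =>
          obtain ⟨k, rfl, rfl⟩ := hz
          simp only [bracket_basis]
          exact bracketBasis_jacobi i j k

/-- The labels of the basis of the subalgebra `𝔤^{(0,-q)}`. -/
def InBorel (q : ℕ) : BMSIndex → Prop
  | .L i => 0 ≤ i
  | .M j => -(q : ℤ) ≤ j
  | .Q k => 1 ≤ k
  | .c₁ => True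
  | .c₂ => True

theorem bracketBasis_mem_borel {q : ℕ} {i j : BMSIndex} (hi : InBorel q i)
    (hj : InBorel q j) : bracketBasis i j ∈
      Submodule.span ℂ (basis '' {i | InBorel q i}) := by
  have hb (i : BMSIndex) (hi : InBorel q i) (r : ℂ) : r • basis i ∈
      Submodule.span ℂ (basis '' {i | InBorel q i}) :=
    Submodule.smul_mem _ _ (Submodule.subset_span ⟨i, hi, rfl⟩)
  have hL (n : ℤ) (h : 0 ≤ n) := hb (.L n) h
  have hM (n : ℤ) (h : -(q : ℤ) ≤ n) := hb (.M n) h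
  have hQ (n : ℤ) (h : 1 ≤ n) := hb (.Q n) h
  have h1 := hb .c₁ trivial
  have h2 := hb .c₂ trivial
  cases i <;> cases j <;> simp only [bracketBasis, L, M, Q, c₁, c₂, Submodule.zero_mem] <;>
    simp only [InBorel] at hi hj
  case L.L => exact Submodule.add_mem _ (hL _ (by omega) _) (h1 _)
  case L.M => exact Submodule.add_mem _ (hM _ (by omega) _) (h2 _)
  case M.L => exact Submodule.neg_mem _ (Submodule.add_mem _ (hM _ (by omega) _) (h2 _))
  case Q.Q => exact Submodule.add_mem _ (hM _ (by omega) _) (h2 _)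
  case L.Q => exact hQ _ (by omega) _
  case Q.L => exact Submodule.neg_mem _ (hQ _ (by omega) _)

/-- The subalgebra `𝔤^{(0,-q)}`, spanned by `L_i` (`i ≥ 0`), `M_j` (`j ≥ -q`), `Q_{k-1/2}`
(`k ≥ 1`) and the central elements. -/
def borel (q : ℕ) : LieSubSuperalgebra BMS where
  toSubmodule := Submodule.span ℂ (basis '' {i | InBorel q i})
  sbracket_mem x y hx hy := by
    change bracket x y ∈ _
    induction hx using Submodule.span_induction with
    | zero => simp
    | add x x' _ _ h h' => rw [map_add, LinearMap.add_apply]; exact Submodule.add_mem _ h h'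
    | smul r x _ h => rw [map_smul, LinearMap.smul_apply]; exact Submodule.smul_mem _ r h
    | mem x hx =>
      obtain ⟨i, hi, rfl⟩ := hx
      induction hy using Submodule.span_induction with
      | zero => simp
      | add x x' _ _ h h' => rw [map_add]; exact Submodule.add_mem _ h h'
      | smul r x _ h => rw [map_smul]; exact Submodule.smul_mem _ r h
      | mem y hy =>
        obtain ⟨j, hj, rfl⟩ := hy
        rw [bracket_basis]
        exact bracketBasis_mem_borel hi hj
  graded x hx := by
    induction hx using Submodule.span_induction with
    | zero => exact ⟨0, zero_mem _, 0, zero_mem _, zero_mem _, zero_mem _, by simp⟩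
    | add x y _ _ h h' =>
      obtain ⟨x₀, h₀, x₁, h₁, e₀, e₁, rfl⟩ := h
      obtain ⟨y₀, g₀, y₁, g₁, d₀, d₁, rfl⟩ := h'
      exact ⟨x₀ + y₀, add_mem h₀ g₀, x₁ + y₁, add_mem h₁ g₁, add_mem e₀ d₀, add_mem e₁ d₁,
        by module⟩
    | smul r x _ h =>
      obtain ⟨x₀, h₀, x₁, h₁, e₀, e₁, rfl⟩ := h
      exact ⟨r • x₀, Submodule.smul_mem _ r h₀, r • x₁, Submodule.smul_mem _ r h₁,
        Submodule.smul_mem _ r e₀, Submodule.smul_mem _ r e₁, smul_add _ _ _⟩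
    | mem x hx =>
      have key : ∀ b : ZMod 2, b = 0 ∨ b = 1 := by decide
      have hx' := Submodule.subset_span (R := ℂ) hx
      obtain ⟨i, hi, rfl⟩ := hx
      have hp := single_mem_part i
      rcases key (parityIndex i) with h | h <;> rw [h] at hp
      · exact ⟨_, hx', 0, zero_mem _, hp, zero_mem _, (add_zero _).symm⟩
      · exact ⟨0, zero_mem _, _, hx', zero_mem _, hp, (zero_add _).symm⟩

theorem single_mem_borel {q : ℕ} {i : BMSIndex} (hi : InBorel q i) :
    basis i ∈ (borel q).toSubmodule :=
  Submodule.subset_span ⟨i, hi, rfl⟩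

/-- `L_i`, `i ≥ 0`, as an element of `𝔤^{(0,-q)}`. -/
def borelL (q : ℕ) (i : ℤ) (hi : 0 ≤ i) : (borel q).toSubmodule := ⟨L i, single_mem_borel hi⟩
/-- `M_j`, `j ≥ -q`, as an element of `𝔤^{(0,-q)}`. -/
def borelM (q : ℕ) (j : ℤ) (hj : -(q : ℤ) ≤ j) : (borel q).toSubmodule :=
  ⟨M j, single_mem_borel hj⟩
/-- The first central element, as an element of `𝔤^{(0,-q)}`. -/
def borelc₁ (q : ℕ) : (borel q).toSubmodule := ⟨c₁, single_mem_borel trivial⟩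
/-- The second central element, as an element of `𝔤^{(0,-q)}`. -/
def borelc₂ (q : ℕ) : (borel q).toSubmodule := ⟨c₂, single_mem_borel trivial⟩

section

variable (W : Type*) [AddCommGroup W] [Module ℂ W] [LieSuperModule BMS W]

/-- Smooth `𝔤`-modules: each vector is killed by `L_i`, `M_i` and `Q_{i-1/2}` for `i` large. -/
def IsSmooth : Prop :=
  ∀ w : W, ∃ N : ℤ, ∀ i : ℤ, N ≤ i → act (L i) w = 0 ∧ act (M i) w = 0 ∧ act (Q i) w = 0

/-- The category of smooth `𝔤`-modules of central charge `(z₁, z₂)`. -/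
structure IsSmoothOfCentralCharge (z₁ z₂ : ℂ) : Prop where
  smooth : IsSmooth W
  act_c₁ : ∀ w : W, act c₁ w = z₁ • w
  act_c₂ : ∀ w : W, act c₂ w = z₂ • w

end

section

variable (q : ℕ) (V : Type*) [AddCommGroup V] [Module ℂ V]
  [LieSuperModule (borel q).toSubmodule V]

/-- The `𝔤^{(0,-q)}`-module `V` has central charge `(z₁, z₂)`. -/
def BorelCentralCharge (z₁ z₂ : ℂ) : Prop :=
  (∀ v : V, act (borelc₁ q) v = z₁ • v) ∧ (∀ v : V, act (borelc₂ q) v = z₂ • v)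

/-- Condition (a) for `t`: `M_t` is injective on `V` if `t > 0`, and `M_0 + (n² - 1)/24 c₂` is
injective on `V` for all nonzero integers `n` if `t = 0`. -/
def ConditionA (t : ℕ) : Prop :=
  (0 < t → Function.Injective fun v : V => act (borelM q t (by omega)) v) ∧
  (t = 0 → ∀ n : ℤ, n ≠ 0 → Function.Injective fun v : V =>
    act (borelM q 0 (by omega) + ((1 / 24 : ℂ) * ((n : ℂ) ^ 2 - 1)) • borelc₂ q) v)

/-- Condition (b) for `t`: `M_i V = 0` for all `i > t` and `L_j V = 0` for all `j > t + q`. -/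
def ConditionB (t : ℕ) : Prop :=
  (∀ (i : ℤ) (hi : (t : ℤ) < i) (v : V), act (borelM q i (by omega)) v = 0) ∧
  (∀ (j : ℤ) (hj : (t : ℤ) + q < j) (v : V), act (borelL q j (by omega)) v = 0)

/-- The induced module `Ind_q(V) = U(𝔤) ⊗_{U(𝔤^{(0,-q)})} V`. -/
abbrev IndQ : Type _ := Ind (borel q) V

end

end BMS

end

/-! All three statements hold for every `W` as in the theorem.

Local nilpotency: for `x = L_i` or `x = M_i` with `i > 0`, the vectors of a smooth module killed by
a power of `x` form a graded submodule (`op_mem_nilSpace`). For large `i` smoothness provides a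
nonzero vector killed by `x`, so by simplicity this submodule is everything (`nilSpace_eq_top`). The
odd operators follow from `Q_r² = M_{2r}`. Local nilpotency clearly implies local finiteness.

Statement 3: take the least `t` such that, for some `q`, the common kernel `topSpace W q t` of the
`M_i`, `Q_{i-1/2}` (`i > t`) and `L_j` (`j > t + q`) is nonzero, and let `V` be this kernel. It is
stable under `𝔤^{(0,-q)}`. If `t > 0`, a nonzero vector of `V` killed by `M_t` would give a nonzero
vector of `topSpace W (q + 1) (t - 1)` (`topSpace_ne_bot_of_kill`), so `M_t` is injective on `V`;
for `t = 0` injectivity is the hypothesis on `W`.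

The map `Ind_q(V) → W` is surjective since `W` is simple. It is injective because the ordered
monomials in the `L_{-1-i}`, `Q_{-i-1/2}`, `M_{-q-1-i}` are independent over `V` inside `W`. This is
proved in three layers (`levelM`, `levelQ`, `levelL`), each with lowering operators: `L_{t+q+1+i}`
against `M_{-q-1-i}`, `Q_{t+i+1/2}` against `Q_{-i-1/2}`, `M_{t+1+i}` against `L_{-1-i}`. The
bracket of partners is a nonzero multiple of `M_t` for `t > 0`, or of some `M_0 + (n² - 1)/24 c₂`
for `t = 0`, hence injective; a larger lowering index gives an `M_k` with `k > t`, which kills `V`.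
In `Ind_q(V)` only the spanning half of the Poincaré–Birkhoff–Witt theorem is needed.

The same independence shows that a submodule of `V` is the intersection of `V` with the
`𝔤`-submodule it generates, so `V` is simple. -/

/-! ## Ordered monomials in a family of operators -/

section Monomials

variable {X : Type*} [AddCommGroup X] [Module ℂ X]

/-- The product `y_{j₁} y_{j₂} ⋯` of the operators labelled by a list. -/
def opProd (y : ℕ → Module.End ℂ X) : List ℕ → Module.End ℂ X
  | [] => 1
  | j :: js => y j * opProd y js

@[simp] theorem opProd_nil (y : ℕ → Module.End ℂ X) (v : X) : opProd y [] v = v := rfl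

@[simp] theorem opProd_cons (y : ℕ → Module.End ℂ X) (j : ℕ) (js : List ℕ) (v : X) :
    opProd y (j :: js) v = y j (opProd y js v) := rfl

/-- The product of the operators labelled by a list in reverse order: the operator of the head of
the list is applied first. -/
def opRevProd (x : ℕ → Module.End ℂ X) : List ℕ → Module.End ℂ X
  | [] => 1
  | i :: is => opRevProd x is * x i

@[simp] theorem opRevProd_nil (y : ℕ → Module.End ℂ X) (v : X) : opRevProd y [] v = v := rfl

@[simp] theorem opRevProd_cons (x : ℕ → Module.End ℂ X) (i : ℕ) (is : List ℕ) (v : X) :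
    opRevProd x (i :: is) v = opRevProd x is (x i v) := rfl

/-- The smallest subspace that contains `Y` and is stable under all `y j`. -/
def opSpan (y : ℕ → Module.End ℂ X) (Y : Submodule ℂ X) : Submodule ℂ X :=
  Submodule.span ℂ {u | ∃ js : List ℕ, ∃ v ∈ Y, opProd y js v = u}

/-- The span of all products of fewer than `n` of the operators `y j`, applied to `Y`. -/
def opFiltration (y : ℕ → Module.End ℂ X) (Y : Submodule ℂ X) (n : ℕ) : Submodule ℂ X :=
  Submodule.span ℂ {u | ∃ js : List ℕ, js.length < n ∧ ∃ v ∈ Y, opProd y js v = u}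

variable {y : ℕ → Module.End ℂ X} {Y : Submodule ℂ X}

theorem opProd_mem_opSpan (js : List ℕ) {v : X} (hv : v ∈ Y) : opProd y js v ∈ opSpan y Y :=
  Submodule.subset_span ⟨js, v, hv, rfl⟩

theorem le_opSpan : Y ≤ opSpan y Y := fun _ hv => opProd_mem_opSpan [] hv

theorem apply_mem_opSpan (j : ℕ) {u : X} (hu : u ∈ opSpan y Y) : y j u ∈ opSpan y Y := by
  induction hu using Submodule.span_induction with
  | zero => simp
  | add u u' _ _ h h' => rw [map_add]; exact Submodule.add_mem _ h h'
  | smul r u _ h => rw [map_smul]; exact Submodule.smul_mem _ r h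
  | mem u hu =>
    obtain ⟨js, v, hv, rfl⟩ := hu
    exact opProd_mem_opSpan (j :: js) hv

theorem opProd_mem_opFiltration {js : List ℕ} {n : ℕ} (h : js.length < n) {v : X} (hv : v ∈ Y) :
    opProd y js v ∈ opFiltration y Y n :=
  Submodule.subset_span ⟨js, h, v, hv, rfl⟩

theorem opFiltration_induction {n : ℕ} {S : Submodule ℂ X} (f : X →ₗ[ℂ] X)
    (h : ∀ js : List ℕ, js.length < n → ∀ v ∈ Y, f (opProd y js v) ∈ S)
    {u : X} (hu : u ∈ opFiltration y Y n) : f u ∈ S := by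
  have : opFiltration y Y n ≤ S.comap f := by
    refine Submodule.span_le.2 ?_
    rintro _ ⟨js, hjs, v, hv, rfl⟩
    exact h js hjs v hv
  exact this hu

theorem opFiltration_zero : opFiltration y Y 0 = ⊥ := by
  simp [opFiltration]

theorem opFiltration_mono : Monotone (opFiltration y Y) := by
  intro m n hmn
  refine Submodule.span_mono ?_
  rintro _ ⟨js, hjs, v, hv, rfl⟩
  exact ⟨js, hjs.trans_le hmn, v, hv, rfl⟩

theorem apply_mem_opFiltration {n : ℕ} (j : ℕ) {u : X} (hu : u ∈ opFiltration y Y n) :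
    y j u ∈ opFiltration y Y (n + 1) :=
  opFiltration_induction (y j)
    (fun js h _ hv => opProd_mem_opFiltration (js := j :: js) (by simpa using h) hv) hu

/-- A permutation of the factors changes a product of operators that commute up to a scalar and
lower order terms by a scalar and lower order terms. -/
theorem opProd_perm {ε : ℂ}
    (hcomm : ∀ (i j n : ℕ), ∀ u ∈ opFiltration y Y n,
      y i (y j u) - ε • y j (y i u) ∈ opFiltration y Y (n + 1))
    {js js' : List ℕ} (h : js.Perm js') : ∃ r : ℂ, ∀ v ∈ Y,
      opProd y js v - r • opProd y js' v ∈ opFiltration y Y js.length := by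
  induction h with
  | nil => exact ⟨1, fun v _ => by simp⟩
  | cons j _ ih =>
    obtain ⟨r, hr⟩ := ih
    refine ⟨r, fun v hv => ?_⟩
    simpa using apply_mem_opFiltration j (hr v hv)
  | swap i j l =>
    -- The remaining factors have length `l.length`, hence lie in the filtration step `l.length +
    -- 1`; the strict inequality in `opFiltration` accounts for the shift.
    refine ⟨ε, fun v hv => ?_⟩
    exact hcomm j i (l.length + 1) _ (opProd_mem_opFiltration (Nat.lt_succ_self _) hv)
  | trans h₁ h₂ ih₁ ih₂ =>
    obtain ⟨r, hr⟩ := ih₁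
    obtain ⟨s, hs⟩ := ih₂
    refine ⟨r * s, fun v hv => ?_⟩
    have h2 := hs v hv
    rw [← h₁.length_eq] at h2
    convert Submodule.add_mem _ (hr v hv) (Submodule.smul_mem _ r h2) using 1
    module

/-- Under the hypothesis that `y` commutes up to a scalar and lower order terms, `opSpan y Y` is
spanned by the ordered products. -/
theorem opSpan_le_span_sorted {ε : ℂ} {R : ℕ → ℕ → Prop}
    (hcomm : ∀ (i j n : ℕ), ∀ u ∈ opFiltration y Y n,
      y i (y j u) - ε • y j (y i u) ∈ opFiltration y Y (n + 1))
    (hsort : ∀ js : List ℕ, (∃ js', js.Perm js' ∧ js'.Pairwise R) ∨ ∃ i l, js.Perm (i :: i :: l) ∧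
      ∀ n, ∀ u ∈ opFiltration y Y n, y i (y i u) ∈ opFiltration y Y (n + 1)) :
    opSpan y Y ≤ Submodule.span ℂ
      {u | ∃ js : List ℕ, js.Pairwise R ∧ ∃ v ∈ Y, opProd y js v = u} := by
  set G := Submodule.span ℂ {u | ∃ js : List ℕ, js.Pairwise R ∧ ∃ v ∈ Y, opProd y js v = u}
  have key : ∀ n, opFiltration y Y n ≤ G := by
    intro n
    induction n with
    | zero => rw [opFiltration_zero]; exact bot_le
    | succ n ih =>
      refine Submodule.span_le.2 ?_
      rintro _ ⟨js, hjs, v, hv, rfl⟩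
      have hle : opFiltration y Y js.length ≤ G :=
        (opFiltration_mono (Nat.le_of_lt_succ hjs)).trans ih
      rcases hsort js with ⟨js', hp, hs⟩ | ⟨i, l, hp, hsq⟩
      · obtain ⟨r, hr⟩ := opProd_perm hcomm hp
        have h1 := hle (hr v hv)
        have h2 : opProd y js' v ∈ G := Submodule.subset_span ⟨js', hs, v, hv, rfl⟩
        simpa using Submodule.add_mem _ h1 (Submodule.smul_mem _ r h2)
      -- A repeated factor is moved to the front, where its square does not lengthen the rest by
      -- two; the whole word is then shorter and the induction on length applies.
      · obtain ⟨r, hr⟩ := opProd_perm hcomm hp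
        have h1 := hr v hv
        have h2 : opProd y (i :: i :: l) v ∈ opFiltration y Y js.length := by
          rw [hp.length_eq]
          exact hsq (l.length + 1) _ (opProd_mem_opFiltration (Nat.lt_succ_self _) hv)
        have h3 := Submodule.add_mem _ h1 (Submodule.smul_mem _ r h2)
        rw [sub_add_cancel] at h3
        exact hle h3
  refine Submodule.span_le.2 ?_
  rintro _ ⟨js, v, hv, rfl⟩
  exact key (js.length + 1) (opProd_mem_opFiltration (Nat.lt_succ_self _) hv)

theorem exists_perm_pairwise_ge (js : List ℕ) : ∃ js', js.Perm js' ∧ js'.Pairwise (· ≥ ·) :=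
  ⟨js.insertionSort (· ≥ ·), (js.perm_insertionSort _).symm, js.pairwise_insertionSort _⟩

/-- Sorting for odd operators: a word without repetition can be ordered strictly, and a repeated
letter can be brought to the front to be squared away. -/
theorem exists_perm_pairwise_gt_or (js : List ℕ) :
    (∃ js', js.Perm js' ∧ js'.Pairwise (· > ·)) ∨ ∃ i l, js.Perm (i :: i :: l) := by
  by_cases h : js.Nodup
  · obtain ⟨js', hp, hs⟩ := exists_perm_pairwise_ge js
    refine Or.inl ⟨js', hp, ?_⟩
    have hn : js'.Pairwise (· ≠ ·) := hp.nodup_iff.1 h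
    exact (hs.and hn).imp fun ⟨h1, h2⟩ => lt_of_le_of_ne h1 h2.symm
  · obtain ⟨i, hi⟩ := List.exists_duplicate_iff_not_nodup.2 h
    obtain ⟨l, hl⟩ := (List.duplicate_iff_sublist.1 hi).exists_perm_append
    exact Or.inr ⟨i, l, hl⟩

/-! ## Freeness -/

/-- The monomials labelled by `R`-ordered lists are independent over `Y`. -/
def IsFreeOver (R : ℕ → ℕ → Prop) (y : ℕ → Module.End ℂ X) (Y : Submodule ℂ X) : Prop :=
  ∀ f : {js : List ℕ // js.Pairwise R} →₀ X, (∀ a, f a ∈ Y) →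
    (f.sum fun a v => opProd y a.1 v) = 0 → f = 0

/-- Every element of `opSpan y Y` is a combination of the monomials labelled by `R`-ordered lists
with coefficients in `Y`. -/
def IsSpanning (R : ℕ → ℕ → Prop) (y : ℕ → Module.End ℂ X) (Y : Submodule ℂ X) : Prop :=
  ∀ u ∈ opSpan y Y, ∃ f : {js : List ℕ // js.Pairwise R} →₀ X, (∀ a, f a ∈ Y) ∧
    (f.sum fun a v => opProd y a.1 v) = u

theorem isSpanning_of_commute {ε : ℂ} {R : ℕ → ℕ → Prop}
    (hcomm : ∀ (i j n : ℕ), ∀ u ∈ opFiltration y Y n,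
      y i (y j u) - ε • y j (y i u) ∈ opFiltration y Y (n + 1))
    (hsort : ∀ js : List ℕ, (∃ js', js.Perm js' ∧ js'.Pairwise R) ∨ ∃ i l, js.Perm (i :: i :: l) ∧
      ∀ n, ∀ u ∈ opFiltration y Y n, y i (y i u) ∈ opFiltration y Y (n + 1)) :
    IsSpanning R y Y := by
  intro u hu
  have hu' := opSpan_le_span_sorted hcomm hsort hu
  induction hu' using Submodule.span_induction with
  | zero => exact ⟨0, fun a => by simp, by simp⟩
  | add u u' hu₁ hu₂ h h' =>
    have hle : Submodule.span ℂ {u | ∃ js : List ℕ, js.Pairwise R ∧ ∃ v ∈ Y, opProd y js v = u} ≤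
        opSpan y Y := by
      refine Submodule.span_mono ?_
      rintro _ ⟨js, _, v, hv, rfl⟩
      exact ⟨js, v, hv, rfl⟩
    obtain ⟨f, hf, rfl⟩ := h (hle hu₁)
    obtain ⟨g, hg, rfl⟩ := h' (hle hu₂)
    classical
    refine ⟨f + g, fun a => Submodule.add_mem _ (hf a) (hg a), ?_⟩
    exact Finsupp.sum_add_index' (by simp) (by simp)
  | smul r u hu₁ h =>
    have hle : Submodule.span ℂ {u | ∃ js : List ℕ, js.Pairwise R ∧ ∃ v ∈ Y, opProd y js v = u} ≤
        opSpan y Y := by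
      refine Submodule.span_mono ?_
      rintro _ ⟨js, _, v, hv, rfl⟩
      exact ⟨js, v, hv, rfl⟩
    obtain ⟨f, hf, rfl⟩ := h (hle hu₁)
    refine ⟨r • f, fun a => Submodule.smul_mem _ r (hf a), ?_⟩
    rw [Finsupp.sum_smul_index' (by simp), Finsupp.smul_sum]
    simp
  | mem u hu₁ =>
    obtain ⟨js, hjs, v, hv, rfl⟩ := hu₁
    classical
    refine ⟨Finsupp.single ⟨js, hjs⟩ v, fun a => ?_, by simp⟩
    rw [Finsupp.single_apply]
    split_ifs
    exacts [hv, Submodule.zero_mem _]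

/-- Independence from a family of operators `D a` that is triangular with respect to the
monomials. -/
theorem isFreeOver_of_triangular {R : ℕ → ℕ → Prop} {K : Type*} [LinearOrder K]
    (key : List ℕ → K) (hkey : Function.Injective key) (D : List ℕ → Module.End ℂ X)
    (h0 : ∀ is js : List ℕ, is.Pairwise R → js.Pairwise R → key js < key is → ∀ v ∈ Y,
      D is (opProd y js v) = 0)
    (h1 : ∀ is : List ℕ, is.Pairwise R → ∀ v ∈ Y, D is (opProd y is v) = 0 → v = 0) :
    IsFreeOver R y Y := by
  intro f hf hsum
  by_contra hne
  have hs : f.support.Nonempty := Finsupp.support_nonempty_iff.2 hne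
  -- The operator attached to the largest monomial of the relation kills all the other terms and
  -- isolates the leading coefficient.
  obtain ⟨a, ha, hmax⟩ := Finset.exists_max_image f.support (fun a => key a.1) hs
  refine Finsupp.mem_support_iff.1 ha (h1 a.1 a.2 _ (hf a) ?_)
  have h2 : D a.1 (f.sum fun a v => opProd y a.1 v) = D a.1 (opProd y a.1 (f a)) := by
    rw [Finsupp.sum, map_sum]
    refine Finset.sum_eq_single_of_mem a ha fun b hb hba => ?_
    refine h0 a.1 b.1 a.2 b.2 ?_ _ (hf b)
    exact lt_of_le_of_ne (hmax b hb) fun h => hba (Subtype.ext (hkey h))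
  rw [← h2, hsum, map_zero]

/-- An intertwining map acts on the coefficients of monomials. Spanning in the source and freeness
in the target suffice, so no independence has to be known in the source. -/
theorem IsFreeOver.injOn_opSpan {X' : Type*} [AddCommGroup X'] [Module ℂ X']
    {y' : ℕ → Module.End ℂ X'} {Y' : Submodule ℂ X'} {R : ℕ → ℕ → Prop} (φ : X' →ₗ[ℂ] X)
    (hφ : ∀ j u, φ (y' j u) = y j (φ u)) (hspan : IsSpanning R y' Y') (hfree : IsFreeOver R y Y)
    (hmem : ∀ u ∈ Y', φ u ∈ Y) (hinj : ∀ u ∈ Y', φ u = 0 → u = 0) :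
    ∀ u ∈ opSpan y' Y', φ u = 0 → u = 0 := by
  intro u hu h0
  obtain ⟨f, hf, rfl⟩ := hspan u hu
  have hprod (js : List ℕ) (v : X') : φ (opProd y' js v) = opProd y js (φ v) := by
    induction js with
    | nil => rfl
    | cons j js ih => simp [hφ, ih]
  have h1 : f.mapRange φ (map_zero φ) = 0 := by
    refine hfree _ (fun a => by simpa using hmem _ (hf a)) ?_
    rw [Finsupp.sum_mapRange_index (by simp)]
    rw [Finsupp.sum, map_sum] at h0
    simpa [hprod, Finsupp.sum] using h0
  have h2 : f = 0 := by
    ext a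
    exact hinj _ (hf a) (by simpa using DFunLike.congr_fun h1 a)
  simp [h2]

theorem map_mem_opSpan {X' : Type*} [AddCommGroup X'] [Module ℂ X']
    {y' : ℕ → Module.End ℂ X'} {Y' : Submodule ℂ X'} (φ : X' →ₗ[ℂ] X)
    (hφ : ∀ j u, φ (y' j u) = y j (φ u)) (hmem : ∀ u ∈ Y', φ u ∈ Y) :
    ∀ u ∈ opSpan y' Y', φ u ∈ opSpan y Y := by
  have : opSpan y' Y' ≤ (opSpan y Y).comap φ := by
    refine Submodule.span_le.2 ?_
    rintro _ ⟨js, v, hv, rfl⟩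
    induction js with
    | nil => exact le_opSpan (hmem v hv)
    | cons j js ih =>
      rw [SetLike.mem_coe, Submodule.mem_comap] at ih ⊢
      rw [opProd_cons, hφ]
      exact apply_mem_opSpan j ih
  exact this

/-- An operator that commutes with `y` and is injective on `Y` is injective on `opSpan y Y`. -/
theorem IsFreeOver.injOn_of_commute {R : ℕ → ℕ → Prop} (hfree : IsFreeOver R y Y)
    (hspan : IsSpanning R y Y) (g : Module.End ℂ X) (hg : ∀ j u, g (y j u) = y j (g u))
    (hmem : ∀ u ∈ Y, g u ∈ Y) (hinj : ∀ u ∈ Y, g u = 0 → u = 0) :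
    ∀ u ∈ opSpan y Y, g u = 0 → u = 0 :=
  hfree.injOn_opSpan g hg hspan hmem hinj

/-- The vector `u` is its own coefficient at the empty monomial. Comparing this with an expansion
over `Y'` identifies `u` with a coefficient in `Y'`. -/
theorem IsFreeOver.mem_of_mem_opSpan {R : ℕ → ℕ → Prop} (hfree : IsFreeOver R y Y)
    {Y' : Submodule ℂ X} (hle : Y' ≤ Y) (hspan : IsSpanning R y Y') {u : X} (hu : u ∈ Y)
    (hu' : u ∈ opSpan y Y') : u ∈ Y' := by
  obtain ⟨f, hf, hfu⟩ := hspan u hu'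
  classical
  have h : f - Finsupp.single ⟨[], List.Pairwise.nil⟩ u = 0 := by
    refine hfree _ (fun a => ?_) ?_
    · rw [Finsupp.sub_apply, Finsupp.single_apply]
      refine Submodule.sub_mem _ (hle (hf a)) ?_
      split_ifs
      exacts [hu, Submodule.zero_mem _]
    · rw [Finsupp.sum_sub_index (by simp), hfu, Finsupp.sum_single_index (by simp)]
      exact sub_self u
  rw [sub_eq_zero] at h
  simpa [h] using hf ⟨[], List.Pairwise.nil⟩

/-! ## Lowering operators -/

/-- Lowering operators `x i` for the operators `y j` over the subspace `Y`: `x i` kills `Y`, and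
`h i j = x i y j - ε y j x i` is, up to the negligible subspaces `N n`, zero for `j < i` and an
injective operator on `Y` that commutes with the `y`'s for `j = i`. -/
structure IsLowering (ε : ℂ) (x y : ℕ → Module.End ℂ X) (h : ℕ → ℕ → Module.End ℂ X)
    (Y : Submodule ℂ X) (N : ℕ → Submodule ℂ X) : Prop where
  swap : ∀ i j u, x i (y j u) = ε • y j (x i u) + h i j u
  kill : ∀ i, ∀ v ∈ Y, x i v = 0
  bot : N 0 = ⊥
  mono : Monotone N
  raise_mem : ∀ j n, ∀ u ∈ N n, y j u ∈ N (n + 1)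
  lower_mem : ∀ i n, ∀ u ∈ N (n + 1), x i u ∈ N n
  of_lt : ∀ i j, j < i → ∀ js : List ℕ, ∀ v ∈ Y, h i j (opProd y js v) ∈ N js.length
  diag : ∀ i, ∀ js : List ℕ, ∀ v ∈ Y,
    h i i (opProd y js v) - opProd y js (h i i v) ∈ N js.length
  diag_mem : ∀ i, ∀ v ∈ Y, h i i v ∈ Y
  diag_inj : ∀ i, ∀ v ∈ Y, h i i v = 0 → v = 0

namespace IsLowering

variable {ε : ℂ} {x : ℕ → Module.End ℂ X} {h : ℕ → ℕ → Module.End ℂ X}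
  {N : ℕ → Submodule ℂ X} {R : ℕ → ℕ → Prop}

/-- Each lowering operator decreases the index of `N` by one, and `N 0 = ⊥`. -/
theorem opRevProd_eq_zero (H : IsLowering ε x y h Y N) (is : List ℕ) :
    ∀ u ∈ N is.length, opRevProd x is u = 0 := by
  induction is with
  | nil => intro u hu; simpa [H.bot] using hu
  | cons i is ih => intro u hu; exact ih _ (H.lower_mem i _ u hu)

/-- Moving `x i` to the right past smaller labels leaves only negligible commutators, and then `x i`
kills the vector of `Y`. For the empty list the truncated `js.length - 1` is harmless because the
result is zero. -/
theorem apply_of_forall_lt (H : IsLowering ε x y h Y N) {i : ℕ} {js : List ℕ}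
    (hjs : ∀ j ∈ js, j < i) {v : X} (hv : v ∈ Y) : x i (opProd y js v) ∈ N (js.length - 1) := by
  induction js with
  | nil => simp [H.kill i v hv]
  | cons j js ih =>
    rw [opProd_cons, H.swap]
    refine Submodule.add_mem _ (Submodule.smul_mem _ _ ?_)
      (H.of_lt i j (hjs j (by simp)) js v hv)
    cases js with
    | nil => simp [H.kill i v hv]
    | cons k js => exact H.raise_mem j _ _ (ih fun l hl => hjs l (by simp [hl]))

theorem apply_cons_of_forall_lt (H : IsLowering ε x y h Y N) {i : ℕ} {js : List ℕ}
    (hlt : ∀ j ∈ js, j < i) {v : X} (hv : v ∈ Y) :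
    x i (opProd y (i :: js) v) - opProd y js (h i i v) ∈ N js.length := by
  have h1 := H.apply_of_forall_lt hlt hv
  have h2 : y i (x i (opProd y js v)) ∈ N js.length := by
    cases js with
    | nil => simp [H.kill i v hv]
    | cons k js => exact H.raise_mem i _ _ h1
  rw [opProd_cons, H.swap, add_sub_assoc]
  exact Submodule.add_mem _ (Submodule.smul_mem _ ε h2) (H.diag i js v hv)

/-- As in differentiating a power, `m` is the number of leading copies of `i`: each contributes one
`h i i`. Copies can only repeat when `ε = 1`, so there is no cancellation of signs. -/
theorem apply_cons_self (H : IsLowering ε x y h Y N) (hR : ∀ i j, R i j → j ≤ i)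
    (hε : ε = 1 ∨ ∀ i, ¬ R i i) {i : ℕ} {js : List ℕ} (hjs : (i :: js).Pairwise R) :
    ∃ m : ℕ, 0 < m ∧ ∀ v ∈ Y,
      x i (opProd y (i :: js) v) - (m : ℂ) • opProd y js (h i i v) ∈ N js.length := by
  induction js with
  | nil => exact ⟨1, one_pos, fun v hv => by
      simpa using H.apply_cons_of_forall_lt (i := i) (js := []) (by simp) hv⟩
  | cons j js ih =>
    have hp := List.pairwise_cons.1 hjs
    rcases (hR _ _ (hp.1 j (by simp))).eq_or_lt with rfl | hlt
    · have hε1 : ε = 1 := hε.resolve_right fun h => h j (hp.1 j (by simp))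
      obtain ⟨m, _, hm⟩ := ih hp.2
      -- The additional unit is the commutator with the first factor; the other `m` come from the
      -- tail.
      refine ⟨m + 1, Nat.succ_pos _, fun v hv => ?_⟩
      have h1 := Submodule.add_mem _ (H.raise_mem j _ _ (hm v hv)) (H.diag j (j :: js) v hv)
      rw [map_sub, map_smul] at h1
      rw [opProd_cons, H.swap, hε1, List.length_cons]
      convert h1 using 1
      rw [opProd_cons y j js (h j j v)]
      push_cast
      module
    · refine ⟨1, one_pos, fun v hv => ?_⟩
      rw [Nat.cast_one, one_smul]
      refine H.apply_cons_of_forall_lt (fun k hk => ?_) hv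
      rcases List.mem_cons.1 hk with rfl | hk
      · exact hlt
      · exact (hR _ _ ((List.pairwise_cons.1 hp.2).1 k hk)).trans_lt hlt

/-- Equal heads are stripped off together. At the first difference the head of `is` exceeds every
label left in `js`, so the result is negligible and the remaining lowering operators kill it. The
bound on lengths guarantees that enough of them remain; it is not needed when nothing is negligible
but zero. -/
theorem opRevProd_of_lt (H : IsLowering ε x y h Y N) (hR : ∀ i j, R i j → j ≤ i)
    (hε : ε = 1 ∨ ∀ i, ¬ R i i) {is js : List ℕ} (his : is.Pairwise R) (hjs : js.Pairwise R)
    (hlt : js < is) (hlen : js.length ≤ is.length ∨ ∀ n, N n = ⊥) :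
    ∀ v ∈ Y, opRevProd x is (opProd y js v) = 0 := by
  induction is generalizing js with
  | nil => exact absurd hlt (List.not_lt_nil js)
  | cons i is ih =>
    intro v hv
    cases js with
    | nil => simp [H.kill i v hv]
    | cons j js =>
      rw [opRevProd_cons]
      rcases List.cons_lt_cons_iff.1 hlt with hji | ⟨rfl, hlt'⟩
      · refine H.opRevProd_eq_zero is _ ?_
        have h1 := H.apply_of_forall_lt (i := i) (js := j :: js) (fun k hk => by
          rcases List.mem_cons.1 hk with rfl | hk
          · exact hji
          · exact (hR _ _ ((List.pairwise_cons.1 hjs).1 k hk)).trans_lt hji) hv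
        rcases hlen with hlen | hN
        · exact H.mono (by simpa using hlen) h1
        · rwa [hN] at h1 ⊢
      · obtain ⟨m, _, hm⟩ := H.apply_cons_self hR hε hjs
        have h1 := hm v hv
        have h2 : opRevProd x is (opProd y js (h j j v)) = 0 :=
          ih (List.pairwise_cons.1 his).2 (List.pairwise_cons.1 hjs).2 hlt'
            (hlen.imp_left fun h => by simpa using h) _ (H.diag_mem j v hv)
        have h3 : x j (opProd y (j :: js) v) - (m : ℂ) • opProd y js (h j j v) ∈ N is.length := by
          rcases hlen with hlen | hN
          · exact H.mono (by simpa using hlen) h1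
          · rwa [hN] at h1 ⊢
        have h4 := H.opRevProd_eq_zero is _ h3
        rwa [map_sub, map_smul, h2, smul_zero, sub_zero] at h4

theorem eq_zero_of_opRevProd (H : IsLowering ε x y h Y N) (hR : ∀ i j, R i j → j ≤ i)
    (hε : ε = 1 ∨ ∀ i, ¬ R i i) {is : List ℕ} (his : is.Pairwise R) :
    ∀ v ∈ Y, opRevProd x is (opProd y is v) = 0 → v = 0 := by
  induction is with
  | nil => intro v _ h0; exact h0
  | cons i is ih =>
    intro v hv h0
    obtain ⟨m, hm0, hm⟩ := H.apply_cons_self hR hε his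
    have h4 := H.opRevProd_eq_zero is _ (hm v hv)
    rw [map_sub, map_smul, ← opRevProd_cons, h0, zero_sub, neg_eq_zero] at h4
    have h5 := (smul_eq_zero.1 h4).resolve_left (by exact_mod_cast hm0.ne')
    exact H.diag_inj i v hv (ih (List.pairwise_cons.1 his).2 _ (H.diag_mem i v hv) h5)

/-- Independence when there are no negligible terms. -/
theorem isFreeOver (H : IsLowering ε x y h Y (fun _ => ⊥)) (hR : ∀ i j, R i j → j ≤ i)
    (hε : ε = 1 ∨ ∀ i, ¬ R i i) : IsFreeOver R y Y :=
  isFreeOver_of_triangular id Function.injective_id (opRevProd x)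
    (fun _ _ his hjs hlt => H.opRevProd_of_lt hR hε his hjs hlt (Or.inr fun _ => rfl))
    (fun _ his => H.eq_zero_of_opRevProd hR hε his)

/-- Independence when shorter monomials are negligible. -/
theorem isFreeOver_of_opFiltration (H : IsLowering ε x y h Y (opFiltration y Y))
    (hR : ∀ i j, R i j → j ≤ i) (hε : ε = 1 ∨ ∀ i, ¬ R i i) : IsFreeOver R y Y := by
  -- Monomials are compared by length before the lexicographic order, since shorter ones are
  -- negligible and are killed by counting alone.
  refine isFreeOver_of_triangular (fun js => toLex (js.length, js))
    (fun _ _ h => congrArg (fun p => (ofLex p).2) h) (opRevProd x)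
    (fun is js his hjs hlt => ?_) (fun _ his => H.eq_zero_of_opRevProd hR hε his)
  rcases Prod.Lex.toLex_lt_toLex.1 hlt with h1 | ⟨h1, h2⟩
  · exact fun v hv => H.opRevProd_eq_zero is _ (opProd_mem_opFiltration h1 hv)
  · exact H.opRevProd_of_lt hR hε his hjs h2 (Or.inl (le_of_eq h1))

end IsLowering

end Monomials

open SuperSpace LieSuperalgebra LieSuperModule

/-! ### Operators that commute with the monomials -/

section Commuting

variable {X : Type*} [AddCommGroup X] [Module ℂ X] {y : ℕ → Module.End ℂ X} {Y : Submodule ℂ X}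

theorem opProd_commute {g : Module.End ℂ X} (hg : ∀ j u, g (y j u) = y j (g u)) (js : List ℕ)
    (v : X) : g (opProd y js v) = opProd y js (g v) := by
  induction js with
  | nil => rfl
  | cons j js ih => rw [opProd_cons, hg, ih, opProd_cons]

theorem mem_opSpan_of_commute {g : Module.End ℂ X} (hg : ∀ j u, g (y j u) = y j (g u))
    (hY : ∀ v ∈ Y, g v ∈ Y) : ∀ u ∈ opSpan y Y, g u ∈ opSpan y Y :=
  map_mem_opSpan g hg hY

theorem opSpan_induction {S : Submodule ℂ X} (f : X →ₗ[ℂ] X)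
    (h : ∀ js : List ℕ, ∀ v ∈ Y, f (opProd y js v) ∈ S)
    {u : X} (hu : u ∈ opSpan y Y) : f u ∈ S := by
  have : opSpan y Y ≤ S.comap f := by
    refine Submodule.span_le.2 ?_
    rintro _ ⟨js, v, hv, rfl⟩
    exact h js v hv
  exact this hu

theorem kill_opSpan_of_commute {g : Module.End ℂ X} {r : ℂ}
    (hg : ∀ j u, g (y j u) = r • y j (g u))
    (hY : ∀ v ∈ Y, g v = 0) {u : X} (hu : u ∈ opSpan y Y) : g u = 0 := by
  have := opSpan_induction (S := ⊥) g (fun js v hv => ?_) hu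
  · simpa using this
  · rw [Submodule.mem_bot]
    induction js with
    | nil => exact hY v hv
    | cons j js ih => rw [opProd_cons, hg, ih, map_zero, smul_zero]

theorem opFiltration_of_commute {n : ℕ} {g : Module.End ℂ X}
    (hg : ∀ j u, g (y j u) = y j (g u)) (hY : ∀ v ∈ Y, g v ∈ Y) {u : X}
    (hu : u ∈ opFiltration y Y n) : g u ∈ opFiltration y Y n :=
  opFiltration_induction g (fun js h v hv => by
    rw [opProd_commute hg]; exact opProd_mem_opFiltration h (hY v hv)) hu

end Commuting

/-! ### Operators of basis elements and their commutation relations -/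

namespace BMS

section

variable {X : Type*} [AddCommGroup X] [Module ℂ X] [LieSuperModule BMS X]

/-- The operator of a basis element. -/
noncomputable def op (X : Type*) [AddCommGroup X] [Module ℂ X] [LieSuperModule BMS X]
    (i : BMSIndex) : Module.End ℂ X := act (basis i)

theorem op_op (i j : BMSIndex) (v : X) :
    op X i (op X j v) = koszulSign (parityIndex i) (parityIndex j) • op X j (op X i v) +
      act (bracketBasis i j) v := by
  have h := act_sbracket (L := BMS) _ _ (basis i) (basis j) (single_mem_part i)
    (single_mem_part j) v
  have hb : sbracket (basis i) (basis j) = bracketBasis i j := bracket_basis i j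
  rw [hb] at h
  rw [h]
  simp [op]

theorem act_L (m : ℤ) : (act (L m) : X →ₗ[ℂ] X) = op X (.L m) := rfl
theorem act_M (m : ℤ) : (act (M m) : X →ₗ[ℂ] X) = op X (.M m) := rfl
theorem act_Q (m : ℤ) : (act (Q m) : X →ₗ[ℂ] X) = op X (.Q m) := rfl
theorem act_c₁ : (act c₁ : X →ₗ[ℂ] X) = op X .c₁ := rfl
theorem act_c₂ : (act c₂ : X →ₗ[ℂ] X) = op X .c₂ := rfl

theorem koszulSign_one_one : koszulSign 1 1 = -1 := by simp [koszulSign, ZMod.val_one]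

theorem act_bracket_LM (m n : ℤ) (v : X) : act (bracketBasis (.L m) (.M n)) v =
    ((m : ℂ) - n) • op X (.M (m + n)) v +
      (if m + n = 0 then (1 / 12 : ℂ) * ((m : ℂ) ^ 3 - m) else 0) • op X .c₂ v := by
  simp only [bracketBasis, map_add, map_smul, LinearMap.add_apply, LinearMap.smul_apply, act_M,
    act_c₂]

theorem act_bracket_ML (m n : ℤ) (v : X) : act (bracketBasis (.M m) (.L n)) v =
    -(((n : ℂ) - m) • op X (.M (n + m)) v +
      (if n + m = 0 then (1 / 12 : ℂ) * ((n : ℂ) ^ 3 - n) else 0) • op X .c₂ v) := by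
  simp only [bracketBasis, map_add, map_neg, map_smul, LinearMap.add_apply, LinearMap.smul_apply,
    LinearMap.neg_apply, act_M, act_c₂]

theorem act_bracket_QQ (m n : ℤ) (v : X) : act (bracketBasis (.Q m) (.Q n)) v =
    (2 : ℂ) • op X (.M (m + n - 1)) v +
      (if m + n - 1 = 0 then (1 / 3 : ℂ) * (((m : ℂ) - 1 / 2) ^ 2 - 1 / 4) else 0) •
        op X .c₂ v := by
  simp only [bracketBasis, map_add, map_smul, LinearMap.add_apply, LinearMap.smul_apply, act_M,
    act_c₂]

theorem act_bracket_LQ (m n : ℤ) (v : X) : act (bracketBasis (.L m) (.Q n)) v =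
    ((m : ℂ) / 2 - ((n : ℂ) - 1 / 2)) • op X (.Q (m + n)) v := by
  simp only [bracketBasis, map_smul, LinearMap.smul_apply, act_Q]

theorem act_bracket_LL (m n : ℤ) (v : X) : act (bracketBasis (.L m) (.L n)) v =
    ((m : ℂ) - n) • op X (.L (m + n)) v +
      (if m + n = 0 then (1 / 12 : ℂ) * ((m : ℂ) ^ 3 - m) else 0) • op X .c₁ v := by
  simp only [bracketBasis, map_add, map_smul, LinearMap.add_apply, LinearMap.smul_apply, act_L,
    act_c₁]

theorem op_M_M (m n : ℤ) (v : X) : op X (.M m) (op X (.M n) v) = op X (.M n) (op X (.M m) v) := by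
  simpa [bracketBasis, parityIndex, koszulSign_zero_left] using op_op (.M m) (.M n) v

theorem op_M_Q (m n : ℤ) (v : X) : op X (.M m) (op X (.Q n) v) = op X (.Q n) (op X (.M m) v) := by
  simpa [bracketBasis, parityIndex, koszulSign_zero_left] using op_op (.M m) (.Q n) v

theorem op_c₂_op (i : BMSIndex) (v : X) : op X .c₂ (op X i v) = op X i (op X .c₂ v) := by
  simpa [bracketBasis, parityIndex, koszulSign_zero_left] using op_op .c₂ i v

theorem op_L_M (m n : ℤ) (v : X) : op X (.L m) (op X (.M n) v) = op X (.M n) (op X (.L m) v) +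
    (((m : ℂ) - n) • op X (.M (m + n)) v +
      (if m + n = 0 then (1 / 12 : ℂ) * ((m : ℂ) ^ 3 - m) else 0) • op X .c₂ v) := by
  rw [op_op, act_bracket_LM]
  simp [parityIndex, koszulSign_zero_left]

theorem op_M_L (m n : ℤ) (v : X) : op X (.M m) (op X (.L n) v) = op X (.L n) (op X (.M m) v) +
    -(((n : ℂ) - m) • op X (.M (n + m)) v +
      (if n + m = 0 then (1 / 12 : ℂ) * ((n : ℂ) ^ 3 - n) else 0) • op X .c₂ v) := by
  rw [op_op, act_bracket_ML]
  simp [parityIndex, koszulSign_zero_left]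

theorem op_L_L (m n : ℤ) (v : X) : op X (.L m) (op X (.L n) v) = op X (.L n) (op X (.L m) v) +
    (((m : ℂ) - n) • op X (.L (m + n)) v +
      (if m + n = 0 then (1 / 12 : ℂ) * ((m : ℂ) ^ 3 - m) else 0) • op X .c₁ v) := by
  rw [op_op, act_bracket_LL]
  simp [parityIndex, koszulSign_zero_left]

theorem op_L_Q (m n : ℤ) (v : X) : op X (.L m) (op X (.Q n) v) = op X (.Q n) (op X (.L m) v) +
    ((m : ℂ) / 2 - ((n : ℂ) - 1 / 2)) • op X (.Q (m + n)) v := by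
  rw [op_op, act_bracket_LQ]
  simp [parityIndex, koszulSign_zero_left]

theorem op_Q_Q (m n : ℤ) (v : X) : op X (.Q m) (op X (.Q n) v) = -op X (.Q n) (op X (.Q m) v) +
    ((2 : ℂ) • op X (.M (m + n - 1)) v +
      (if m + n - 1 = 0 then (1 / 3 : ℂ) * (((m : ℂ) - 1 / 2) ^ 2 - 1 / 4) else 0) •
        op X .c₂ v) := by
  rw [op_op, act_bracket_QQ]
  simp [parityIndex, koszulSign_one_one]

/-- The square of `Q_r` is `M_{2r}` for `r ≠ 0`. -/
theorem op_Q_Q_self (m : ℤ) (v : X) : op X (.Q m) (op X (.Q m) v) = op X (.M (2 * m - 1)) v := by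
  have h := op_Q_Q (X := X) m m v
  rw [if_neg (by omega), zero_smul, add_zero, show m + m - 1 = 2 * m - 1 by ring] at h
  have h2 : (2 : ℂ) • op X (.Q m) (op X (.Q m) v) = (2 : ℂ) • op X (.M (2 * m - 1)) v := by
    rw [two_smul]
    nth_rewrite 1 [h]
    abel
  exact smul_right_injective X (two_ne_zero (α := ℂ)) h2

/-- Stability of a subspace under the basis elements with labels in `S`. -/
def IsStable (S : Set BMSIndex) (Y : Submodule ℂ X) : Prop :=
  ∀ s ∈ S, ∀ u ∈ Y, op X s u ∈ Y

theorem IsStable.act_mem_of_span {S : Set BMSIndex} {Y : Submodule ℂ X} {u : X}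
    (h : ∀ s ∈ S, op X s u ∈ Y) {a : BMS} (ha : a ∈ Submodule.span ℂ (basis '' S)) :
    act a u ∈ Y := by
  have : Submodule.span ℂ (basis '' S) ≤ Y.comap (act (V := X).flip u) := by
    refine Submodule.span_le.2 ?_
    rintro _ ⟨s, hs, rfl⟩
    exact h s hs
  exact this ha

/-- An operator from `S` is moved through a word from left to right; each bracket met on the way is
again in the span of `S`, so the induction on the word treats all of `S` at once. -/
theorem IsStable.opSpan {S₀ S : Set BMSIndex} {f : ℕ → BMSIndex} {Y : Submodule ℂ X}
    (hY : IsStable S₀ Y) (hS : ∀ s ∈ S, s ∈ S₀ ∨ ∃ j, s = f j)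
    (hbr : ∀ s ∈ S, ∀ j, bracketBasis s (f j) ∈ Submodule.span ℂ (basis '' S)) :
    IsStable S (opSpan (fun j => op X (f j)) Y) := by
  intro s hs u hu
  refine opSpan_induction (op X s) (fun js v hv => ?_) hu
  induction js generalizing s with
  | nil =>
    rcases hS s hs with h | ⟨j, rfl⟩
    · exact le_opSpan (hY s h v hv)
    · exact apply_mem_opSpan j (le_opSpan hv)
  | cons j js ih =>
    rw [opProd_cons, op_op]
    exact Submodule.add_mem _
      (Submodule.smul_mem _ _ (apply_mem_opSpan (y := fun j => op X (f j)) j (ih s hs)))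
      (IsStable.act_mem_of_span (fun s' hs' => ih s' hs') (hbr s hs j))

/-! ## The three levels of an induced module -/

/-- The labels of `M_{-q-1}, M_{-q-2}, …`. -/
def lowM (q j : ℕ) : BMSIndex := .M (-(q + 1 + j : ℤ))
/-- The labels of `Q_{-1/2}, Q_{-3/2}, …`. -/
def lowQ (j : ℕ) : BMSIndex := .Q (-(j : ℤ))
/-- The labels of `L_{-1}, L_{-2}, …`. -/
def lowL (j : ℕ) : BMSIndex := .L (-(j + 1 : ℤ))

/-- The span of the products of the `M_{-q-1-j}` applied to `Y`. -/
noncomputable def levelM (q : ℕ) (Y : Submodule ℂ X) : Submodule ℂ X :=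
  opSpan (fun j => op X (lowM q j)) Y
/-- The span of the products of the `Q_{-j-1/2}` applied to `Y`. -/
noncomputable def levelQ (Y : Submodule ℂ X) : Submodule ℂ X := opSpan (fun j => op X (lowQ j)) Y
/-- The span of the products of the `L_{-j-1}` applied to `Y`. -/
noncomputable def levelL (Y : Submodule ℂ X) : Submodule ℂ X := opSpan (fun j => op X (lowL j)) Y

/-- The labels of the basis of `⋃ q, 𝔤^{(0,-q)}`. -/
def InBorelM : BMSIndex → Prop
  | .L i => 0 ≤ i
  | .Q k => 1 ≤ k
  | _ => True

/-- The labels of the `L_i` with `i ≥ 0`, of all `M_i` and `Q_r`, and of the central elements. -/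
def InBorelQ : BMSIndex → Prop
  | .L i => 0 ≤ i
  | _ => True

/-- The three levels adjoin the missing `M`, then the missing `Q`, then the missing `L`. In this
order the labels available after each step span a subalgebra, so stability propagates until all of
`𝔤` acts. -/
theorem isStable_levelM {q : ℕ} {Y : Submodule ℂ X} (hY : IsStable {i | InBorel q i} Y) :
    IsStable {i | InBorelM i} (levelM q Y) := by
  refine hY.opSpan (fun s hs => ?_) (fun s hs j => ?_)
  · cases s with
    | L i => exact Or.inl hs
    | Q k => exact Or.inl hs
    | c₁ => exact Or.inl trivial
    | c₂ => exact Or.inl trivial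
    | M i =>
      by_cases h : -(q : ℤ) ≤ i
      · exact Or.inl h
      · refine Or.inr ⟨(-i - q - 1).toNat, ?_⟩
        rw [lowM, BMSIndex.M.injEq]
        omega
  · have hb (i : BMSIndex) (hi : InBorelM i) (r : ℂ) : r • basis i ∈
        Submodule.span ℂ (basis '' {i | InBorelM i}) :=
      Submodule.smul_mem _ _ (Submodule.subset_span ⟨i, hi, rfl⟩)
    cases s <;> simp only [bracketBasis, lowM, M, c₂, Submodule.zero_mem]
    exact Submodule.add_mem _ (hb (.M _) trivial _) (hb .c₂ trivial _)

theorem isStable_levelQ {Y : Submodule ℂ X} (hY : IsStable {i | InBorelM i} Y) :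
    IsStable {i | InBorelQ i} (levelQ Y) := by
  refine hY.opSpan (fun s hs => ?_) (fun s hs j => ?_)
  · cases s with
    | L i => exact Or.inl hs
    | M i => exact Or.inl trivial
    | c₁ => exact Or.inl trivial
    | c₂ => exact Or.inl trivial
    | Q i =>
      by_cases h : 1 ≤ i
      · exact Or.inl h
      · refine Or.inr ⟨(-i).toNat, ?_⟩
        rw [lowQ, BMSIndex.Q.injEq]
        omega
  · have hb (i : BMSIndex) (hi : InBorelQ i) (r : ℂ) : r • basis i ∈
        Submodule.span ℂ (basis '' {i | InBorelQ i}) :=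
      Submodule.smul_mem _ _ (Submodule.subset_span ⟨i, hi, rfl⟩)
    cases s <;> simp only [bracketBasis, lowQ, M, Q, c₂, Submodule.zero_mem]
    · exact hb (.Q _) trivial _
    · exact Submodule.add_mem _ (hb (.M _) trivial _) (hb .c₂ trivial _)

theorem isStable_levelL {Y : Submodule ℂ X} (hY : IsStable {i | InBorelQ i} Y) :
    IsStable Set.univ (levelL Y) := by
  refine hY.opSpan (fun s hs => ?_) (fun s hs j => ?_)
  · cases s with
    | Q i => exact Or.inl trivial
    | M i => exact Or.inl trivial
    | c₁ => exact Or.inl trivial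
    | c₂ => exact Or.inl trivial
    | L i =>
      by_cases h : 0 ≤ i
      · exact Or.inl h
      · refine Or.inr ⟨(-i - 1).toNat, ?_⟩
        rw [lowL, BMSIndex.L.injEq]
        omega
  · rw [Set.image_univ, basis.span_eq]
    trivial

theorem isSpanning_levelM (q : ℕ) (Y : Submodule ℂ X) :
    IsSpanning (· ≥ ·) (fun j => op X (lowM q j)) Y := by
  refine isSpanning_of_commute (ε := 1) (fun i j n u hu => ?_)
    (fun js => Or.inl (exists_perm_pairwise_ge js))
  have h : op X (lowM q i) (op X (lowM q j) u) = op X (lowM q j) (op X (lowM q i) u) :=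
    op_M_M _ _ _
  rw [h, one_smul, sub_self]
  exact Submodule.zero_mem _

/-- Anticommutators and squares of the `Q`'s are multiples of operators `M_k`. These commute with
the `Q`'s and preserve `Y`, so they do not lengthen words, and strictly decreasing words suffice. -/
theorem isSpanning_levelQ {Y : Submodule ℂ X} (hY : ∀ k, ∀ u ∈ Y, op X (.M k) u ∈ Y) :
    IsSpanning (· > ·) (fun j => op X (lowQ j)) Y := by
  have hM (k : ℤ) (n : ℕ) (u : X) (hu : u ∈ opFiltration (fun j => op X (lowQ j)) Y n) :
      op X (.M k) u ∈ opFiltration (fun j => op X (lowQ j)) Y (n + 1) :=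
    opFiltration_mono (Nat.le_succ n)
      (opFiltration_of_commute (fun _ _ => op_M_Q _ _ _) (hY k) hu)
  refine isSpanning_of_commute (ε := -1) (fun i j n u hu => ?_) (fun js => ?_)
  · have h := op_Q_Q (-(i : ℤ)) (-(j : ℤ)) u
    rw [if_neg (by omega), zero_smul, add_zero] at h
    rw [lowQ, lowQ, h]
    convert Submodule.smul_mem _ (2 : ℂ) (hM (-(i : ℤ) + -(j : ℤ) - 1) n u hu) using 1
    module
  · refine (exists_perm_pairwise_gt_or js).imp_right ?_
    rintro ⟨i, l, h⟩
    refine ⟨i, l, h, fun n u hu => ?_⟩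
    rw [lowQ, op_Q_Q_self]
    exact hM _ n u hu

/-- The bracket of two `L`'s of negative degree is a multiple of a single such `L`, with no central
term, so reordering costs only shorter words. -/
theorem isSpanning_levelL (Y : Submodule ℂ X) :
    IsSpanning (· ≥ ·) (fun j => op X (lowL j)) Y := by
  refine isSpanning_of_commute (ε := 1) (fun i j n u hu => ?_)
    (fun js => Or.inl (exists_perm_pairwise_ge js))
  have h := op_L_L (-(i + 1 : ℤ)) (-(j + 1 : ℤ)) u
  rw [if_neg (by omega), zero_smul, add_zero] at h
  have h2 : BMSIndex.L (-(i + 1 : ℤ) + -(j + 1 : ℤ)) = lowL (i + j + 1) := by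
    rw [lowL, BMSIndex.L.injEq]
    push_cast
    ring
  rw [h2] at h
  rw [lowL, lowL, h, one_smul, add_sub_cancel_left]
  exact Submodule.smul_mem _ _
    (apply_mem_opFiltration (y := fun j => op X (lowL j)) (i + j + 1) hu)

/-! ### Independence of the monomials at each level -/

/-- `Y` is stable under `c₂` and the `M_k` with `k ≥ 0`, killed by the `M_k` with `k > t`, and the
operators that condition (a) requires to be injective are injective on `Y`. -/
structure IsTop (t : ℕ) (Y : Submodule ℂ X) : Prop where
  M_mem : ∀ k : ℤ, 0 ≤ k → ∀ v ∈ Y, op X (.M k) v ∈ Y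
  c₂_mem : ∀ v ∈ Y, op X .c₂ v ∈ Y
  M_kill : ∀ k : ℤ, (t : ℤ) < k → ∀ v ∈ Y, op X (.M k) v = 0
  inj_pos : 0 < t → ∀ v ∈ Y, op X (.M t) v = 0 → v = 0
  inj_zero : t = 0 → ∀ n : ℤ, n ≠ 0 → ∀ v ∈ Y,
    op X (.M 0) v + ((1 / 24 : ℂ) * ((n : ℂ) ^ 2 - 1)) • op X .c₂ v = 0 → v = 0

namespace IsTop

variable {t : ℕ} {Y : Submodule ℂ X}

/-- Common form of the diagonal brackets at all three levels: the central term is present only for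
`t = 0`, where it must combine with `M_0` into the operator of condition (a) for a suitable `n`. -/
theorem eq_zero (H : IsTop t Y) {v : X} (hv : v ∈ Y) {k n : ℤ} (hk : k = t) (hn : n ≠ 0)
    {c d : ℂ} (hc : c ≠ 0) (hd : t = 0 → d = c * ((1 / 24 : ℂ) * ((n : ℂ) ^ 2 - 1)))
    (h : c • op X (.M k) v + (if k = 0 then d else 0) • op X .c₂ v = 0) : v = 0 := by
  subst hk
  rcases Nat.eq_zero_or_pos t with rfl | ht
  · refine H.inj_zero rfl n hn v hv ?_
    rw [if_pos (by simp), hd rfl, mul_smul, ← smul_add] at h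
    exact (smul_eq_zero.1 h).resolve_left hc
  · refine H.inj_pos ht v hv ?_
    rw [if_neg (by omega), zero_smul, add_zero] at h
    exact (smul_eq_zero.1 h).resolve_left hc

/-- The `M_k` and `c₂` commute with the new operators, so they act on the coefficients of the
monomials, and kernels and injectivity carry over from `Y`. -/
theorem opSpan (H : IsTop t Y) {f : ℕ → BMSIndex} {R : ℕ → ℕ → Prop}
    (hf : ∀ k j (u : X), op X (.M k) (op X (f j) u) = op X (f j) (op X (.M k) u))
    (hspan : IsSpanning R (fun j => op X (f j)) Y) (hfree : IsFreeOver R (fun j => op X (f j)) Y) :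
    IsTop t (opSpan (fun j => op X (f j)) Y) where
  M_mem k hk := mem_opSpan_of_commute (fun j u => hf k j u) (H.M_mem k hk)
  c₂_mem := mem_opSpan_of_commute (fun j u => op_c₂_op _ _) H.c₂_mem
  M_kill k hk v hv := kill_opSpan_of_commute (r := 1)
    (fun j u => by rw [one_smul]; exact hf k j u) (H.M_kill k hk) hv
  inj_pos ht := hfree.injOn_of_commute hspan (op X (.M t)) (fun j u => hf t j u)
    (H.M_mem t (by omega)) (H.inj_pos ht)
  inj_zero ht n hn := hfree.injOn_of_commute hspan
    (op X (.M 0) + ((1 / 24 : ℂ) * ((n : ℂ) ^ 2 - 1)) • op X .c₂)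
    (fun j u => by simp [hf, op_c₂_op])
    (fun u hu => Submodule.add_mem _ (H.M_mem 0 le_rfl u hu)
      (Submodule.smul_mem _ _ (H.c₂_mem u hu)))
    (H.inj_zero ht n hn)

theorem isFreeOver_levelM (H : IsTop t Y) (q : ℕ)
    (hL : ∀ j : ℤ, (t : ℤ) + q < j → ∀ v ∈ Y, op X (.L j) v = 0) :
    IsFreeOver (· ≥ ·) (fun j => op X (lowM q j)) Y := by
  have hM (k : ℤ) (js : List ℕ) (v : X) := opProd_commute (y := fun j => op X (lowM q j))
    (g := op X (.M k)) (fun j u => op_M_M _ _ _) js v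
  have hc (js : List ℕ) (v : X) := opProd_commute (y := fun j => op X (lowM q j))
    (g := op X .c₂) (fun j u => op_c₂_op _ _) js v
  have key : IsLowering 1 (fun i => op X (.L (t + q + 1 + i : ℤ))) (fun j => op X (lowM q j))
      (fun i j => act (bracketBasis (.L (t + q + 1 + i : ℤ)) (lowM q j))) Y (fun _ => ⊥) :=
    { swap := fun i j u => by
        rw [op_op]
        rfl
      kill := fun i v hv => hL _ (by omega) v hv
      bot := rfl
      mono := fun _ _ _ => le_rfl
      raise_mem := fun j n u hu => by
        rw [Submodule.mem_bot] at hu ⊢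
        rw [hu, map_zero]
      lower_mem := fun j n u hu => by
        rw [Submodule.mem_bot] at hu ⊢
        rw [hu, map_zero]
      of_lt := fun i j hij js v hv => by
        rw [Submodule.mem_bot, lowM, act_bracket_LM, if_neg (by omega), hM,
          H.M_kill _ (by omega) v hv]
        simp
      diag := fun i js v hv => by
        rw [Submodule.mem_bot, lowM, act_bracket_LM, act_bracket_LM, hM, hc, map_add, map_smul,
          map_smul, sub_self]
      diag_mem := fun i v hv => by
        rw [lowM, act_bracket_LM]
        exact Submodule.add_mem _ (Submodule.smul_mem _ _ (H.M_mem _ (by omega) v hv))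
          (Submodule.smul_mem _ _ (H.c₂_mem v hv))
      diag_inj := fun i v hv h => by
        rw [lowM, act_bracket_LM] at h
        -- With `m = q + 1 + i`, the bracket of `L_{t+m}` and `M_{-m}` is `(t + 2m) M_t` plus a
        -- central term. For `t = 0` it equals `2m (M_0 + (m² - 1)/24 c₂)`, so `n = m`.
        refine H.eq_zero hv (k := t + q + 1 + i + -(q + 1 + i)) (n := q + 1 + i) (by ring)
          (by omega) ?_ (fun ht => ?_) h
        · have : ((t + 2 * (q + 1 + i) : ℕ) : ℂ) ≠ 0 := Nat.cast_ne_zero.2 (by omega)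
          push_cast at this ⊢
          convert this using 1
          ring
        · subst ht
          push_cast
          ring }
  exact key.isFreeOver (fun _ _ h => h) (Or.inl rfl)

theorem isFreeOver_levelQ (H : IsTop t Y)
    (hQ : ∀ j : ℤ, (t : ℤ) < j → ∀ v ∈ Y, op X (.Q j) v = 0) :
    IsFreeOver (· > ·) (fun j => op X (lowQ j)) Y := by
  have hM (k : ℤ) (js : List ℕ) (v : X) := opProd_commute (y := fun j => op X (lowQ j))
    (g := op X (.M k)) (fun j u => op_M_Q _ _ _) js v
  have hc (js : List ℕ) (v : X) := opProd_commute (y := fun j => op X (lowQ j))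
    (g := op X .c₂) (fun j u => op_c₂_op _ _) js v
  have key : IsLowering (-1) (fun i => op X (.Q (t + 1 + i : ℤ))) (fun j => op X (lowQ j))
      (fun i j => act (bracketBasis (.Q (t + 1 + i : ℤ)) (lowQ j))) Y (fun _ => ⊥) :=
    { swap := fun i j u => by
        rw [op_op, ← koszulSign_one_one]
        rfl
      kill := fun i v hv => hQ _ (by omega) v hv
      bot := rfl
      mono := fun _ _ _ => le_rfl
      raise_mem := fun j n u hu => by
        rw [Submodule.mem_bot] at hu ⊢
        rw [hu, map_zero]
      lower_mem := fun j n u hu => by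
        rw [Submodule.mem_bot] at hu ⊢
        rw [hu, map_zero]
      of_lt := fun i j hij js v hv => by
        rw [Submodule.mem_bot, lowQ, act_bracket_QQ, if_neg (by omega), hM,
          H.M_kill _ (by omega) v hv]
        simp
      diag := fun i js v hv => by
        rw [Submodule.mem_bot, lowQ, act_bracket_QQ, act_bracket_QQ, hM, hc, map_add, map_smul,
          map_smul, sub_self]
      diag_mem := fun i v hv => by
        rw [lowQ, act_bracket_QQ]
        exact Submodule.add_mem _ (Submodule.smul_mem _ _ (H.M_mem _ (by omega) v hv))
          (Submodule.smul_mem _ _ (H.c₂_mem v hv))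
      diag_inj := fun i v hv h => by
        rw [lowQ, act_bracket_QQ] at h
        -- For `t = 0` and `r = i + 1/2` the central coefficient is `(r² - 1/4)/3 = 2 ((2r)² -
        -- 1)/24`, so `n = 2r = 2i + 1`.
        refine H.eq_zero hv (k := t + 1 + i + -i - 1) (n := 2 * i + 1) (by ring) (by omega)
          two_ne_zero (fun ht => ?_) h
        subst ht
        push_cast
        ring }
  exact key.isFreeOver (fun _ _ h => le_of_lt h) (Or.inr fun _ => lt_irrefl _)

/-- Unlike before, the lowering operators `M_k` have brackets with the `L`'s that do not commute
with the remaining `L`'s. Moving `M_k` through a word is therefore controlled only modulo shorter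
words, and the length filtration plays the role of the negligible subspaces. -/
theorem isFreeOver_levelL (H : IsTop t Y) (hM : ∀ k : ℤ, ∀ v ∈ Y, op X (.M k) v ∈ Y) :
    IsFreeOver (· ≥ ·) (fun j => op X (lowL j)) Y := by
  set y : ℕ → Module.End ℂ X := fun j => op X (lowL j)
  have hc (js : List ℕ) (v : X) := opProd_commute (y := y)
    (g := op X .c₂) (fun j u => op_c₂_op _ _) js v
  have hcF (n : ℕ) (u : X) (hu : u ∈ opFiltration y Y n) : op X .c₂ u ∈ opFiltration y Y n :=
    opFiltration_of_commute (y := y) (fun j u => op_c₂_op _ _) H.c₂_mem hu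
  have hML (k : ℤ) (j : ℕ) (u : X) : op X (.M k) (y j u) = y j (op X (.M k) u) +
      -(((-(j + 1 : ℤ) : ℤ) - k : ℂ) • op X (.M (-(j + 1 : ℤ) + k)) u +
      (if -(j + 1 : ℤ) + k = 0 then (1 / 12 : ℂ) *
        (((-(j + 1 : ℤ) : ℤ) : ℂ) ^ 3 - ((-(j + 1 : ℤ) : ℤ) : ℂ)) else 0) • op X .c₂ u) :=
    op_M_L k _ u
  -- An arbitrary `M_k` does not lengthen words: a bracket replaces an `L` by another `M` or a
  -- central term, and `Y` is stable under every `M`.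
  have hMF' (js : List ℕ) (v : X) (hv : v ∈ Y) (k : ℤ) :
      op X (.M k) (opProd y js v) ∈ opFiltration y Y (js.length + 1) := by
    induction js generalizing k with
    | nil => exact opProd_mem_opFiltration (js := []) (by simp) (hM k v hv)
    | cons j js ih =>
      have hle := opFiltration_mono (y := y) (Y := Y) (Nat.le_succ (js.length + 1))
      rw [opProd_cons, hML]
      refine Submodule.add_mem _ (apply_mem_opFiltration j (ih k)) (Submodule.neg_mem _ (hle ?_))
      exact Submodule.add_mem _ (Submodule.smul_mem _ _ (ih _)) (Submodule.smul_mem _ _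
        (hcF _ _ (opProd_mem_opFiltration (Nat.lt_succ_self _) hv)))
  have hMF (n : ℕ) (u : X) (hu : u ∈ opFiltration y Y n) (k : ℤ) :
      op X (.M k) u ∈ opFiltration y Y n :=
    opFiltration_induction (op X (.M k))
      (fun js h v hv => opFiltration_mono (Nat.succ_le_of_lt h) (hMF' js v hv k)) hu
  -- For `k > t` the term in which `M_k` reaches `Y` vanishes; the others have lost an `L` to a
  -- bracket, so the length drops.
  have hkill (js : List ℕ) (v : X) (hv : v ∈ Y) (k : ℤ) (hk : (t : ℤ) < k) :
      op X (.M k) (opProd y js v) ∈ opFiltration y Y js.length := by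
    induction js with
    | nil => rw [opProd_nil, H.M_kill k hk v hv]; exact Submodule.zero_mem _
    | cons j js ih =>
      have h1 : opProd y js v ∈ opFiltration y Y (js.length + 1) :=
        opProd_mem_opFiltration (Nat.lt_succ_self _) hv
      rw [opProd_cons, hML]
      exact Submodule.add_mem _ (apply_mem_opFiltration j ih) (Submodule.neg_mem _
        (Submodule.add_mem _ (Submodule.smul_mem _ _ (hMF _ _ h1 _))
          (Submodule.smul_mem _ _ (hcF _ _ h1))))
  have hcomm (js : List ℕ) (v : X) (hv : v ∈ Y) (k : ℤ) :
      op X (.M k) (opProd y js v) - opProd y js (op X (.M k) v) ∈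
        opFiltration y Y js.length := by
    induction js with
    | nil => simp
    | cons j js ih =>
      have h1 : opProd y js v ∈ opFiltration y Y (js.length + 1) :=
        opProd_mem_opFiltration (Nat.lt_succ_self _) hv
      rw [opProd_cons, hML, add_sub_right_comm, opProd_cons, ← map_sub]
      exact Submodule.add_mem _ (apply_mem_opFiltration j ih) (Submodule.neg_mem _
        (Submodule.add_mem _ (Submodule.smul_mem _ _ (hMF _ _ h1 _))
          (Submodule.smul_mem _ _ (hcF _ _ h1))))
  have key : IsLowering 1 (fun i => op X (.M (t + 1 + i : ℤ))) y
      (fun i j => act (bracketBasis (.M (t + 1 + i : ℤ)) (lowL j))) Y (opFiltration y Y) :=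
    { swap := fun i j u => by
        simp only [y]
        rw [op_op]
        rfl
      kill := fun i v hv => H.M_kill _ (by omega) v hv
      bot := opFiltration_zero
      mono := opFiltration_mono
      raise_mem := fun j n u hu => apply_mem_opFiltration j hu
      lower_mem := fun i n u hu => opFiltration_induction (op X (.M (t + 1 + i : ℤ)))
        (fun js h v hv => opFiltration_mono (Nat.le_of_lt_succ h) (hkill js v hv _ (by omega))) hu
      of_lt := fun i j hij js v hv => by
        rw [lowL, act_bracket_ML, if_neg (by omega), zero_smul, add_zero]
        exact Submodule.neg_mem _ (Submodule.smul_mem _ _ (hkill js v hv _ (by omega)))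
      diag := fun i js v hv => by
        rw [lowL, act_bracket_ML, act_bracket_ML, hc, map_neg, map_add, map_smul, map_smul]
        convert Submodule.neg_mem _ (Submodule.smul_mem _
          (((-(i + 1 : ℤ) : ℤ) : ℂ) - ((t + 1 + i : ℤ) : ℂ))
          (hcomm js v hv (-(i + 1 : ℤ) + (t + 1 + i)))) using 1
        module
      diag_mem := fun i v hv => by
        rw [lowL, act_bracket_ML]
        exact Submodule.neg_mem _ (Submodule.add_mem _ (Submodule.smul_mem _ _ (hM _ v hv))
          (Submodule.smul_mem _ _ (H.c₂_mem v hv)))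
      diag_inj := fun i v hv h => by
        rw [lowL, act_bracket_ML, neg_eq_zero] at h
        -- With `m = i + 1`, the bracket of `L_{-m}` and `M_{t+m}` has leading coefficient `-(t +
        -- 2m)`. For `t = 0` it is `-2m (M_0 + (m² - 1)/24 c₂)`, so `n = m`.
        refine H.eq_zero hv (k := -(i + 1) + (t + 1 + i)) (n := i + 1) (by ring) (by omega)
          ?_ (fun ht => ?_) h
        · have : ((t + 2 * (i + 1) : ℕ) : ℂ) ≠ 0 := Nat.cast_ne_zero.2 (by omega)
          rw [← neg_ne_zero]
          push_cast at this ⊢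
          convert this using 1
          ring
        · subst ht
          push_cast
          ring }
  exact key.isFreeOver_of_opFiltration (fun _ _ h => h) (Or.inl rfl)

end IsTop

end

end BMS

/-! ### Vectors killed by a power of an operator -/

section NilSpace

variable {X : Type*} [AddCommGroup X] [Module ℂ X]

/-- The vectors killed by a power of `f`. -/
def nilSpace (f : Module.End ℂ X) : Submodule ℂ X where
  carrier := {w | ∃ n : ℕ, (f ^ n) w = 0}
  zero_mem' := ⟨0, by simp⟩
  add_mem' := by
    rintro a b ⟨m, hm⟩ ⟨n, hn⟩
    refine ⟨m + n, ?_⟩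
    rw [map_add, pow_add, Module.End.mul_apply, Module.End.mul_apply, hn, ← Module.End.mul_apply,
      ← pow_add, add_comm m n, pow_add, Module.End.mul_apply, hm]
    simp
  smul_mem' := by
    rintro r a ⟨m, hm⟩
    exact ⟨m, by rw [map_smul, hm, smul_zero]⟩

theorem mem_nilSpace_of_apply {f : Module.End ℂ X} {w : X} (h : f w ∈ nilSpace f) :
    w ∈ nilSpace f := by
  obtain ⟨n, hn⟩ := h
  exact ⟨n + 1, by rw [pow_succ, Module.End.mul_apply, hn]⟩

theorem apply_mem_nilSpace_of_commute {f g : Module.End ℂ X} (h : ∀ v, f (g v) = g (f v)) {w : X}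
    (hw : w ∈ nilSpace f) : g w ∈ nilSpace f := by
  obtain ⟨n, hn⟩ := hw
  have hn' : ∀ n v, (f ^ n) (g v) = g ((f ^ n) v) := by
    intro n
    induction n with
    | zero => intro v; rfl
    | succ n ih => intro v; rw [pow_succ, Module.End.mul_apply, h, ih, Module.End.mul_apply]
  exact ⟨n, by rw [hn', hn, map_zero]⟩

theorem isLocallyNilpotentOp_of_nilSpace {f : Module.End ℂ X} (h : nilSpace f = ⊤) :
    IsLocallyNilpotentOp f := by
  intro v
  obtain ⟨n, hn⟩ : v ∈ nilSpace f := h ▸ Submodule.mem_top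
  exact ⟨n + 1, Nat.succ_pos _, by rw [pow_succ', Module.End.mul_apply, hn, map_zero]⟩

theorem IsLocallyNilpotentOp.isLocallyFiniteOp {V : Type*} [AddCommGroup V] [Module ℂ V]
    {f : V →ₗ[ℂ] V} (h : IsLocallyNilpotentOp f) : IsLocallyFiniteOp f := by
  intro v
  obtain ⟨n, -, hn⟩ := h v
  have hle : Submodule.span ℂ (Set.range fun k : ℕ => (f ^ k) v) ≤
      Submodule.span ℂ ((fun k : ℕ => (f ^ k) v) '' Set.Iio n) := by
    refine Submodule.span_le.2 ?_
    rintro _ ⟨k, rfl⟩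
    rcases lt_or_ge k n with hk | hk
    · exact Submodule.subset_span ⟨k, hk, rfl⟩
    · obtain ⟨m, rfl⟩ := Nat.exists_eq_add_of_le hk
      simp only
      rw [add_comm, pow_add, Module.End.mul_apply, hn, map_zero]
      exact Submodule.zero_mem _
  have : FiniteDimensional ℂ (Submodule.span ℂ ((fun k : ℕ => (f ^ k) v) '' Set.Iio n)) :=
    FiniteDimensional.span_of_finite ℂ ((Set.finite_Iio n).image _)
  exact Submodule.finiteDimensional_of_le hle

end NilSpace

/-! ### Inducing subspaces and the submodules they generate -/

namespace BMS

section

variable {X : Type*} [AddCommGroup X] [Module ℂ X] [LieSuperModule BMS X]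

/-- The `𝔤`-submodule generated by a `𝔤^{(0,-q)}`-stable subspace. -/
noncomputable def generated (q : ℕ) (Y : Submodule ℂ X) : Submodule ℂ X :=
  levelL (levelQ (levelM q Y))

theorem le_generated (q : ℕ) (Y : Submodule ℂ X) : Y ≤ generated q Y :=
  le_opSpan.trans (le_opSpan.trans le_opSpan)

theorem act_mem_generated {q : ℕ} {Y : Submodule ℂ X} (hY : IsStable {i | InBorel q i} Y)
    (a : BMS) {u : X} (hu : u ∈ generated q Y) : act a u ∈ generated q Y := by
  refine IsStable.act_mem_of_span (S := Set.univ)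
    (fun s hs => isStable_levelL (isStable_levelQ (isStable_levelM hY)) s hs u hu) ?_
  rw [Set.image_univ, basis.span_eq]
  trivial

/-- The conditions on a `𝔤^{(0,-q)}`-stable subspace that make the `𝔤`-submodule it generates an
induced module. -/
structure IsInducing (q t : ℕ) (Y : Submodule ℂ X) : Prop extends IsTop t Y where
  stable : IsStable {i | InBorel q i} Y
  Q_kill : ∀ k : ℤ, (t : ℤ) < k → ∀ v ∈ Y, op X (.Q k) v = 0
  L_kill : ∀ j : ℤ, (t : ℤ) + q < j → ∀ v ∈ Y, op X (.L j) v = 0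

namespace IsInducing

variable {q t : ℕ} {Y : Submodule ℂ X}

theorem isFreeOver_levelM (H : IsInducing q t Y) :
    IsFreeOver (· ≥ ·) (fun j => op X (lowM q j)) Y :=
  H.toIsTop.isFreeOver_levelM q H.L_kill

theorem isTop_levelM (H : IsInducing q t Y) : IsTop t (levelM q Y) :=
  H.toIsTop.opSpan (fun _ _ _ => op_M_M _ _ _) (isSpanning_levelM q Y) H.isFreeOver_levelM

theorem isFreeOver_levelQ (H : IsInducing q t Y) :
    IsFreeOver (· > ·) (fun j => op X (lowQ j)) (levelM q Y) :=
  H.isTop_levelM.isFreeOver_levelQ fun k hk v hv => kill_opSpan_of_commute (r := 1)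
    (fun j u => by rw [one_smul]; exact (op_M_Q _ _ _).symm) (H.Q_kill k hk) hv

theorem _root_.BMS.isSpanning_levelQ_levelM (h : IsStable {i | InBorel q i} Y) :
    IsSpanning (· > ·) (fun j => op X (lowQ j)) (levelM q Y) :=
  isSpanning_levelQ fun k u hu => isStable_levelM h (.M k) trivial u hu

theorem isTop_levelQ (H : IsInducing q t Y) : IsTop t (levelQ (levelM q Y)) :=
  H.isTop_levelM.opSpan (fun _ _ _ => op_M_Q _ _ _) (isSpanning_levelQ_levelM H.stable)
    H.isFreeOver_levelQ

theorem isFreeOver_levelL (H : IsInducing q t Y) :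
    IsFreeOver (· ≥ ·) (fun j => op X (lowL j)) (levelQ (levelM q Y)) :=
  H.isTop_levelQ.isFreeOver_levelL fun k u hu =>
    isStable_levelQ (isStable_levelM H.stable) (.M k) trivial u hu

/-- A homomorphism is injective on the submodule generated by `Y'` if it is injective on `Y'` and
maps `Y'` to an inducing subspace. -/
theorem injOn_generated {X' : Type*} [AddCommGroup X'] [Module ℂ X'] [LieSuperModule BMS X']
    (H : IsInducing q t Y) {Y' : Submodule ℂ X'} (hY' : IsStable {i | InBorel q i} Y')
    (φ : X' →ₗ[ℂ] X) (hφ : ∀ a u, φ (op X' a u) = op X a (φ u)) (hmem : ∀ u ∈ Y', φ u ∈ Y)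
    (hinj : ∀ u ∈ Y', φ u = 0 → u = 0) : ∀ u ∈ generated q Y', φ u = 0 → u = 0 := by
  have hM := map_mem_opSpan φ (y' := fun j => op X' (lowM q j)) (y := fun j => op X (lowM q j))
    (fun _ _ => hφ _ _) hmem
  have hQ := map_mem_opSpan φ (y' := fun j => op X' (lowQ j)) (y := fun j => op X (lowQ j))
    (fun _ _ => hφ _ _) hM
  have hiM := H.isFreeOver_levelM.injOn_opSpan φ (fun _ _ => hφ _ _)
    (isSpanning_levelM q Y') hmem hinj
  have hiQ := H.isFreeOver_levelQ.injOn_opSpan φ (fun _ _ => hφ _ _)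
    (isSpanning_levelQ_levelM hY') hM hiM
  exact H.isFreeOver_levelL.injOn_opSpan φ (fun _ _ => hφ _ _) (isSpanning_levelL _) hQ hiQ

/-- A stable subspace of an inducing subspace `Y` is the intersection of `Y` with the submodule
that it generates. -/
theorem mem_of_mem_generated (H : IsInducing q t Y) {Y' : Submodule ℂ X} (hle : Y' ≤ Y)
    (hY' : IsStable {i | InBorel q i} Y') {u : X} (hu : u ∈ Y) (hu' : u ∈ generated q Y') :
    u ∈ Y' := by
  have hM : levelM q Y' ≤ levelM q Y := map_mem_opSpan LinearMap.id (fun _ _ => rfl) hle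
  have hQ : levelQ (levelM q Y') ≤ levelQ (levelM q Y) :=
    map_mem_opSpan LinearMap.id (fun _ _ => rfl) hM
  have h1 := H.isFreeOver_levelL.mem_of_mem_opSpan hQ (isSpanning_levelL _)
    (le_opSpan (le_opSpan hu)) hu'
  have h2 := H.isFreeOver_levelQ.mem_of_mem_opSpan hM (isSpanning_levelQ_levelM hY')
    (le_opSpan hu) h1
  exact H.isFreeOver_levelM.mem_of_mem_opSpan hle (isSpanning_levelM q Y') hu h2

end IsInducing

/-! ## Local nilpotency -/

theorem op_isSuperSubmodule {N : Submodule ℂ X} (hact : ∀ i, ∀ v ∈ N, op X i v ∈ N)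
    (hpar : ∀ v ∈ N, parity v ∈ N) : IsSuperSubmodule BMS X N where
  act_mem a v hv := by
    refine IsStable.act_mem_of_span (S := Set.univ) (fun s _ => hact s v hv) ?_
    rw [Set.image_univ, basis.span_eq]
    trivial
  graded v hv := by
    refine ⟨(1 / 2 : ℂ) • (v + parity v), N.smul_mem _ (N.add_mem hv (hpar v hv)),
      (1 / 2 : ℂ) • (v - parity v), N.smul_mem _ (N.sub_mem hv (hpar v hv)), ?_, ?_, by module⟩
    · rw [mem_part_iff]
      simp [parity_parity, add_comm]
    · rw [mem_part_iff, map_smul, map_sub, parity_parity, ZMod.val_one]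
      module

/-- The degree of a basis element; `Q_{k-1/2}` is given degree `k`. -/
def degree : BMSIndex → ℤ
  | .L i => i
  | .M i => i
  | .Q i => i
  | _ => 0

/-- The labels of the noncentral basis elements. -/
def IsNoncentral : BMSIndex → Prop
  | .c₁ => False
  | .c₂ => False
  | _ => True

theorem op_c₁_op (i : BMSIndex) (v : X) : op X .c₁ (op X i v) = op X i (op X .c₁ v) := by
  simpa [bracketBasis, parityIndex, koszulSign_zero_left] using op_op .c₁ i v

/-- In a smooth module, the vectors killed by a power of `x = L_i` or `x = M_i`, `i > 0`, form a
submodule. -/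
theorem op_mem_nilSpace (hX : IsSmooth X) {x : BMSIndex} (hx0 : parityIndex x = 0)
    (hxd : 0 < degree x)
    (hbr : ∀ y, IsNoncentral y → bracketBasis x y ∈ Submodule.span ℂ (basis ''
      {z | IsNoncentral z → degree z = degree x + degree y}))
    (y : BMSIndex) {w : X} (hw : w ∈ nilSpace (op X x)) : op X y w ∈ nilSpace (op X x) := by
  set N := nilSpace (op X x)
  have hcentral (z : BMSIndex) (hz : ¬ IsNoncentral z) {u : X} (hu : u ∈ N) : op X z u ∈ N := by
    refine apply_mem_nilSpace_of_commute (fun v => ?_) hu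
    cases z with
    | c₁ => exact (op_c₁_op _ _).symm
    | c₂ => exact (op_c₂_op _ _).symm
    | _ => exact absurd trivial hz
  obtain ⟨m, hm⟩ := hw
  have hpow (j : ℕ) : (op X x ^ j) w ∈ N :=
    ⟨m, by rw [← Module.End.mul_apply, ← pow_add, add_comm, pow_add, Module.End.mul_apply, hm,
      map_zero]⟩
  choose D hD using fun j => hX ((op X x ^ j) w)
  -- Only finitely many `x^j w` are nonzero, so one degree bound `E` serves for all of them.
  obtain ⟨E, hE⟩ : ∃ E : ℤ, ∀ j < m, D j ≤ E := by
    refine ⟨∑ j ∈ Finset.range m, |D j|, fun j hj => (le_abs_self _).trans ?_⟩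
    exact Finset.single_le_sum (f := fun j => |D j|) (fun _ _ => abs_nonneg _)
      (Finset.mem_range.2 hj)
  -- Downward induction on the degree of `y`: from degree `E` on, `y` kills every `x^j w`, and
  -- bracketing with `x` strictly raises the degree.
  have key (d : ℕ) : ∀ y, IsNoncentral y → E - d ≤ degree y → ∀ j,
      op X y ((op X x ^ j) w) ∈ N := by
    induction d with
    | zero =>
      intro y hy hd j
      rcases lt_or_ge j m with hj | hj
      · have hz : op X y ((op X x ^ j) w) = 0 := by
          have := hD j (degree y) (by have := hE j hj; push_cast at hd; omega)
          cases y with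
          | L i => exact this.1
          | M i => exact this.2.1
          | Q i => exact this.2.2
          | _ => exact hy.elim
        rw [hz]
        exact N.zero_mem
      · obtain ⟨k, rfl⟩ := Nat.exists_eq_add_of_le hj
        rw [add_comm, pow_add, Module.End.mul_apply, hm, map_zero, map_zero]
        exact N.zero_mem
    | succ d ih =>
      intro y hy hd
      -- Downward induction on `j`, starting from `x^m w = 0`: `x y x^j w = y x^{j+1} w + [x, y] x^j
      -- w`, where the first term is known from `j + 1` and the second from higher degree or
      -- centrality.
      have hdown (k : ℕ) : ∀ j, m ≤ j + k → op X y ((op X x ^ j) w) ∈ N := by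
        induction k with
        | zero =>
          intro j hj
          obtain ⟨k, rfl⟩ := Nat.exists_eq_add_of_le hj
          simp only [add_zero] at *
          rw [add_comm, pow_add, Module.End.mul_apply, hm, map_zero, map_zero]
          exact N.zero_mem
        | succ k ihk =>
          intro j hj
          refine mem_nilSpace_of_apply ?_
          rw [op_op, hx0, koszulSign_zero_left, one_smul]
          refine N.add_mem ?_ (IsStable.act_mem_of_span (fun z hz => ?_) (hbr y hy))
          · rw [← Module.End.mul_apply (op X x), ← pow_succ']
            exact ihk (j + 1) (by omega)
          · by_cases hzc : IsNoncentral z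
            · refine ih z hzc ?_ j
              have := hz hzc
              push_cast at hd
              omega
            · exact hcentral z hzc (hpow j)
      exact fun j => hdown m j (by omega)
  by_cases hy : IsNoncentral y
  · exact key (E - degree y).toNat y hy (by omega) 0
  · exact hcentral y hy ⟨m, hm⟩

theorem parity_op (i : BMSIndex) (v : X) :
    parity (op X i v) = ((-1 : ℂ) ^ (parityIndex i).val) • op X i (parity v) := by
  rw [op, parity_act, parity_of_mem (single_mem_part i), map_smul, LinearMap.smul_apply]

theorem nilSpace_eq_top (hX : IsSmooth X) (hsimple : IsSimpleSuperModule BMS X) {x : BMSIndex}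
    (hx0 : parityIndex x = 0) (hxd : 0 < degree x)
    (hbr : ∀ y, IsNoncentral y → bracketBasis x y ∈ Submodule.span ℂ (basis ''
      {z | IsNoncentral z → degree z = degree x + degree y}))
    {w : X} (hw : w ≠ 0) (hxw : op X x w = 0) : nilSpace (op X x) = ⊤ := by
  refine (hsimple.eq_bot_or_eq_top _ (op_isSuperSubmodule
    (fun y v hv => op_mem_nilSpace hX hx0 hxd hbr y hv)
    (fun v hv => apply_mem_nilSpace_of_commute (fun u => ?_) hv))).resolve_left fun h => hw ?_
  · rw [parity_op, hx0]
    simp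
  · have : w ∈ nilSpace (op X x) := ⟨1, by simpa using hxw⟩
    simpa [h] using this

/-- In a simple smooth module, the `L_i`, `M_i`, `Q_{i-1/2}` with `i` large are locally
nilpotent. -/
theorem exists_isLocallyNilpotentOp (hX : IsSmooth X) (hsimple : IsSimpleSuperModule BMS X) :
    ∃ l : ℕ, 0 < l ∧ ∀ i : ℤ, (l : ℤ) ≤ i →
      IsLocallyNilpotentOp (act (V := X) (L i)) ∧ IsLocallyNilpotentOp (act (V := X) (M i)) ∧
      IsLocallyNilpotentOp (act (V := X) (Q i)) := by
  obtain ⟨w, hw⟩ := @exists_ne X hsimple.nontrivial 0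
  obtain ⟨D, hD⟩ := hX w
  have hb {d : ℤ} (i : BMSIndex) (hi : IsNoncentral i → degree i = d) (r : ℂ) : r • basis i ∈
      Submodule.span ℂ (basis '' {z | IsNoncentral z → degree z = d}) :=
    Submodule.smul_mem _ _ (Submodule.subset_span ⟨i, hi, rfl⟩)
  have hL (i : ℤ) (h0 : 0 < i) (h1 : D ≤ i) : nilSpace (op X (.L i)) = ⊤ := by
    refine nilSpace_eq_top hX hsimple rfl h0 (fun y hy => ?_) hw (hD i h1).1
    cases y with
    | L j => exact Submodule.add_mem _ (hb (.L _) (fun _ => rfl) _) (hb .c₁ (fun h => h.elim) _)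
    | M j => exact Submodule.add_mem _ (hb (.M _) (fun _ => rfl) _) (hb .c₂ (fun h => h.elim) _)
    | Q j => exact hb (.Q _) (fun _ => rfl) _
    | _ => exact hy.elim
  have hM (i : ℤ) (h0 : 0 < i) (h1 : D ≤ i) : nilSpace (op X (.M i)) = ⊤ := by
    refine nilSpace_eq_top hX hsimple rfl h0 (fun y hy => ?_) hw (hD i h1).2.1
    cases y with
    | L j => exact Submodule.neg_mem _ (Submodule.add_mem _
        (hb (.M _) (fun _ => by simp [degree, add_comm]) _) (hb .c₂ (fun h => h.elim) _))
    | M j => exact Submodule.zero_mem _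
    | Q j => exact Submodule.zero_mem _
    | _ => exact hy.elim
  -- Degrees from `D` on kill the vector `w`, and `1` ensures positive degree. For the odd operators
  -- `2i - 1 ≥ i`, so the square `M_{2i-1}` is covered by the same bound.
  refine ⟨(max D 1).toNat, by omega, fun i hi =>
    ⟨isLocallyNilpotentOp_of_nilSpace (hL i (by omega) (by omega)),
    isLocallyNilpotentOp_of_nilSpace (hM i (by omega) (by omega)), fun v => ?_⟩⟩
  obtain ⟨n, hn, hv⟩ := isLocallyNilpotentOp_of_nilSpace
    (hM (2 * i - 1) (by omega) (by omega)) v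
  refine ⟨2 * n, by omega, ?_⟩
  have h2 : (act (Q i) : Module.End ℂ X) ^ 2 = op X (.M (2 * i - 1)) := by
    ext u
    rw [pow_two, Module.End.mul_apply]
    exact op_Q_Q_self i u
  rw [pow_mul]
  exact (congrArg (fun f : Module.End ℂ X => (f ^ n) v) h2).trans hv

end

end BMS

/-! ## The universal property of induced modules -/

section Enveloping

variable {L : Type*} [AddCommGroup L] [Module ℂ L] [LieSuperalgebra L]

theorem SuperEnveloping.induction {C : SuperEnveloping L → Prop}
    (algebraMap : ∀ r : ℂ, C (algebraMap ℂ _ r)) (ι : ∀ x : L, C (SuperEnveloping.ι x))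
    (mul : ∀ a b, C a → C b → C (a * b)) (add : ∀ a b, C a → C b → C (a + b))
    (a : SuperEnveloping L) : C a := by
  obtain ⟨z, rfl⟩ := RingQuot.mkAlgHom_surjective ℂ (SuperEnveloping.Rel L) a
  change C (SuperEnveloping.mkAlgHom L z)
  induction z using TensorAlgebra.induction with
  | algebraMap r => rw [AlgHom.commutes]; exact algebraMap r
  | ι x => exact ι x
  | mul a b ha hb => rw [map_mul]; exact mul _ _ ha hb
  | add a b ha hb => rw [map_add]; exact add _ _ ha hb

variable (X : Type*) [AddCommGroup X] [Module ℂ X] [LieSuperModule L X]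

theorem SuperEnveloping.action_rel ⦃s t : TensorAlgebra ℂ L⦄ (h : SuperEnveloping.Rel L s t) :
    TensorAlgebra.lift ℂ (act : L →ₗ[ℂ] Module.End ℂ X) s =
      TensorAlgebra.lift ℂ (act : L →ₗ[ℂ] Module.End ℂ X) t := by
  obtain ⟨a, b, x, y, hx, hy⟩ := h
  ext v
  simp [act_sbracket a b x y hx hy]

/-- The action of the enveloping algebra on a module. -/
noncomputable def SuperEnveloping.action : SuperEnveloping L →ₐ[ℂ] Module.End ℂ X :=
  RingQuot.liftAlgHom ℂ ⟨TensorAlgebra.lift ℂ (act : L →ₗ[ℂ] Module.End ℂ X),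
    SuperEnveloping.action_rel X⟩

theorem SuperEnveloping.action_ι (x : L) :
    SuperEnveloping.action X (SuperEnveloping.ι x) = act x := by
  have h := RingQuot.liftAlgHom_mkAlgHom_apply ℂ
    (TensorAlgebra.lift ℂ (act : L →ₗ[ℂ] Module.End ℂ X))
    (SuperEnveloping.action_rel (L := L) X) (TensorAlgebra.ι ℂ x)
  rw [TensorAlgebra.lift_ι_apply] at h
  exact h

theorem SuperEnveloping.parity_action (a : SuperEnveloping L) : ∀ v : X,
    parity (SuperEnveloping.action X a v) =
      SuperEnveloping.action X (SuperEnveloping.parityHom a) (parity v) := by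
  induction a using SuperEnveloping.induction with
  | algebraMap r => intro v; simp [Algebra.algebraMap_eq_smul_one]
  | ι x => intro v; rw [SuperEnveloping.parityHom_ι, action_ι, action_ι, parity_act]
  | mul a b ha hb =>
    intro v
    rw [map_mul, map_mul, map_mul, Module.End.mul_apply, Module.End.mul_apply, ha, hb]
  | add a b ha hb =>
    intro v
    rw [map_add, map_add, map_add, LinearMap.add_apply, LinearMap.add_apply, map_add, ha, hb]

namespace Ind

variable {X}
variable (H : LieSubSuperalgebra L)
variable (V : Type*) [AddCommGroup V] [Module ℂ V] [LieSuperModule H.toSubmodule V]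

/-- The canonical map `V → Ind V`. -/
noncomputable def incl : V →ₗ[ℂ] Ind H V := mk H V ∘ₗ TensorProduct.mk ℂ (SuperEnveloping L) V 1

theorem incl_act (h : H.toSubmodule) (v : V) : incl H V (act h v) = act (h : L) (incl H V v) := by
  have h1 : mk H V (SuperEnveloping.ι (h : L) ⊗ₜ[ℂ] v - 1 ⊗ₜ[ℂ] (act h v)) = 0 :=
    (Submodule.Quotient.mk_eq_zero _).2 (Submodule.subset_span ⟨h, v, rfl⟩)
  rw [map_sub, sub_eq_zero] at h1
  refine h1.symm.trans ?_
  change _ = SuperEnveloping.ι (h : L) • mk H V (1 ⊗ₜ v)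
  rw [← mk_smul, TensorProduct.smul_tmul', smul_eq_mul, mul_one]

theorem eq_top_of_incl_mem {G : Submodule ℂ (Ind H V)} (h1 : ∀ v, incl H V v ∈ G)
    (h2 : ∀ x : L, ∀ u ∈ G, act x u ∈ G) : G = ⊤ := by
  have h3 (a : SuperEnveloping L) : ∀ u ∈ G, a • u ∈ G := by
    induction a using SuperEnveloping.induction with
    | algebraMap r => intro u hu; rw [algebraMap_smul]; exact G.smul_mem r hu
    | ι x => exact h2 x
    | mul a b ha hb => intro u hu; rw [mul_smul]; exact ha _ (hb u hu)
    | add a b ha hb => intro u hu; rw [add_smul]; exact G.add_mem (ha u hu) (hb u hu)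
  refine eq_top_iff.2 fun z _ => ?_
  obtain ⟨z, rfl⟩ := mk_surjective H V z
  induction z using TensorProduct.induction_on with
  | zero => simp
  | tmul a v =>
    have h4 := h3 a _ (h1 v)
    change a • mk H V (1 ⊗ₜ v) ∈ G at h4
    rwa [← mk_smul, TensorProduct.smul_tmul', smul_eq_mul, mul_one] at h4
  | add a b ha hb => rw [map_add]; exact G.add_mem (ha trivial) (hb trivial)

variable {H V}

/-- The linear map `U(L) ⊗ V → X`, `u ⊗ v ↦ u (f v)`. -/
noncomputable def preLift (f : V →ₗ[ℂ] X) : SuperEnveloping L ⊗[ℂ] V →ₗ[ℂ] X :=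
  TensorProduct.lift ((SuperEnveloping.action X).toLinearMap.compl₂ f)

theorem preLift_tmul (f : V →ₗ[ℂ] X) (a : SuperEnveloping L) (v : V) :
    preLift f (a ⊗ₜ v) = SuperEnveloping.action X a (f v) := rfl

theorem preLift_smul (f : V →ₗ[ℂ] X) (a : SuperEnveloping L) (z : SuperEnveloping L ⊗[ℂ] V) :
    preLift f (a • z) = SuperEnveloping.action X a (preLift f z) := by
  induction z using TensorProduct.induction_on with
  | zero => simp
  | tmul b v =>
    rw [TensorProduct.smul_tmul', preLift_tmul, preLift_tmul, smul_eq_mul, map_mul,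
      Module.End.mul_apply]
  | add x y hx hy => rw [smul_add, map_add, hx, hy, map_add, map_add]

/-- The homomorphism `Ind V → X` that extends a homomorphism `V → X` of `H`-modules. -/
noncomputable def lift (f : V →ₗ[ℂ] X)
    (hf : ∀ (h : H.toSubmodule) v, f (act h v) = act (h : L) (f v)) :
    Ind H V →ₗ[ℂ] X :=
  ((indRel H V).restrictScalars ℂ).liftQ (preLift f) (by
    intro z hz
    rw [Submodule.restrictScalars_mem] at hz
    rw [LinearMap.mem_ker]
    induction hz using Submodule.span_induction with
    | mem z hz =>
      obtain ⟨h, v, rfl⟩ := hz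
      rw [map_sub, preLift_tmul, preLift_tmul, SuperEnveloping.action_ι, hf, map_one, sub_eq_zero]
      rfl
    | zero => simp
    | add x y _ _ hx hy => rw [map_add, hx, hy, add_zero]
    | smul a z _ hz => rw [preLift_smul, hz, map_zero])

variable (f : V →ₗ[ℂ] X) (hf : ∀ (h : H.toSubmodule) v, f (act h v) = act (h : L) (f v))

theorem lift_mk (z : SuperEnveloping L ⊗[ℂ] V) : lift f hf (mk H V z) = preLift f z := rfl

theorem lift_incl (v : V) : lift f hf (incl H V v) = f v := by
  change preLift f (1 ⊗ₜ v) = f v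
  rw [preLift_tmul, map_one, Module.End.one_apply]

theorem lift_act (x : L) (z : Ind H V) : lift f hf (act x z) = act x (lift f hf z) := by
  obtain ⟨z, rfl⟩ := mk_surjective H V z
  change lift f hf (SuperEnveloping.ι x • mk H V z) = _
  rw [← mk_smul, lift_mk, lift_mk, preLift_smul, SuperEnveloping.action_ι]

theorem lift_parityOp (hp : ∀ v, f (parity v) = parity (f v)) (z : Ind H V) :
    lift f hf (parityOp H V z) = parity (lift f hf z) := by
  obtain ⟨z, rfl⟩ := mk_surjective H V z
  induction z using TensorProduct.induction_on with
  | zero => simp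
  | tmul a v =>
    rw [parityOp_mk, lift_mk, lift_mk, preLift_tmul, preLift_tmul,
      SuperEnveloping.parity_action, hp]
  | add x y hx hy => simp only [map_add, hx, hy]

theorem mem_part_iff_parityOp {a : ZMod 2} {z : Ind H V} :
    z ∈ part a ↔ parityOp H V z = ((-1 : ℂ) ^ a.val) • z := by
  change parityOp H V z - ((-1 : ℂ) ^ a.val) • z = 0 ↔ _
  exact sub_eq_zero

/-- A bijective homomorphism `Ind V → X` gives an isomorphism. -/
noncomputable def isoOfBijective (hp : ∀ v, f (parity v) = parity (f v))
    (hbij : Function.Bijective (lift f hf)) : SuperModuleIso L X (Ind H V) where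
  toLinearEquiv := (LinearEquiv.ofBijective (lift f hf) hbij).symm
  map_part a v hv := by
    rw [mem_part_iff_parityOp]
    refine hbij.1 ?_
    have h (w : X) : lift f hf ((LinearEquiv.ofBijective (lift f hf) hbij).symm w) = w :=
      LinearEquiv.apply_symm_apply (LinearEquiv.ofBijective (lift f hf) hbij) w
    rw [lift_parityOp f hf hp, map_smul, h, parity_of_mem hv]
  map_act x v := by
    refine hbij.1 ?_
    have h (w : X) : lift f hf ((LinearEquiv.ofBijective (lift f hf) hbij).symm w) = w :=
      LinearEquiv.apply_symm_apply (LinearEquiv.ofBijective (lift f hf) hbij) w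
    rw [lift_act, h, h]

end Ind

end Enveloping

/-! ### Stable graded subspaces as modules over the subalgebra -/

namespace BMS

section

variable {X : Type*} [AddCommGroup X] [Module ℂ X] [LieSuperModule BMS X]

theorem parity_mem_opSpan {f : ℕ → BMSIndex} {Y : Submodule ℂ X} (hY : ∀ v ∈ Y, parity v ∈ Y) :
    ∀ u ∈ opSpan (fun j => op X (f j)) Y, parity u ∈ opSpan (fun j => op X (f j)) Y := by
  intro u hu
  refine opSpan_induction parity (fun js v hv => ?_) hu
  induction js with
  | nil => exact le_opSpan (hY v hv)
  | cons j js ih =>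
    rw [opProd_cons, parity_op]
    exact Submodule.smul_mem _ _ (apply_mem_opSpan (y := fun j => op X (f j)) j ih)

theorem isSuperSubmodule_generated {q : ℕ} {Y : Submodule ℂ X}
    (hY : IsStable {i | InBorel q i} Y) (hp : ∀ v ∈ Y, parity v ∈ Y) :
    IsSuperSubmodule BMS X (generated q Y) :=
  op_isSuperSubmodule (fun i _ hv => act_mem_generated hY (basis i) hv)
    (parity_mem_opSpan (parity_mem_opSpan (parity_mem_opSpan hp)))

theorem IsStable.act_mem_of_borel {q : ℕ} {Y : Submodule ℂ X} (hY : IsStable {i | InBorel q i} Y)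
    (h : (borel q).toSubmodule) {v : X} (hv : v ∈ Y) : act (h : BMS) v ∈ Y :=
  IsStable.act_mem_of_span (fun s hs => hY s hs v hv) h.2

/-- A `𝔤^{(0,-q)}`-stable graded subspace as a `𝔤^{(0,-q)}`-module. -/
@[reducible]
noncomputable def borelModule {q : ℕ} {Y : Submodule ℂ X} (hY : IsStable {i | InBorel q i} Y)
    (hp : ∀ v ∈ Y, parity v ∈ Y) : LieSuperModule (borel q).toSubmodule Y where
  part a := (part a : Submodule ℂ X).comap Y.subtype
  isCompl := by
    have hc := SuperSpace.isCompl (V := X)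
    refine ⟨?_, ?_⟩
    · rw [Submodule.disjoint_def]
      intro x h0 h1
      exact Subtype.ext (Submodule.disjoint_def.1 hc.disjoint x.1 h0 h1)
    · rw [codisjoint_iff, eq_top_iff]
      rintro ⟨x, hx⟩ -
      refine Submodule.mem_sup.2
        ⟨⟨(1 / 2 : ℂ) • (x + parity x), Y.smul_mem _ (Y.add_mem hx (hp x hx))⟩, ?_,
        ⟨(1 / 2 : ℂ) • (x - parity x), Y.smul_mem _ (Y.sub_mem hx (hp x hx))⟩, ?_, ?_⟩
      · rw [Submodule.mem_comap, Submodule.subtype_apply, mem_part_iff]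
        simp [parity_parity, add_comm]
      · rw [Submodule.mem_comap, Submodule.subtype_apply, mem_part_iff, map_smul, map_sub,
          parity_parity, ZMod.val_one]
        module
      · refine Subtype.ext ?_
        rw [Submodule.coe_add]
        module
  act := LinearMap.mk₂ ℂ (fun h v => ⟨act (h : BMS) (v : X), hY.act_mem_of_borel h v.2⟩)
    (fun x y z => Subtype.ext (by simp)) (fun c x y => Subtype.ext (by simp))
    (fun x y z => Subtype.ext (by simp)) (fun c x y => Subtype.ext (by simp))
  act_mem a b x v hx hv := LieSuperModule.act_mem (L := BMS) a b x.1 v.1 hx hv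
  act_sbracket a b x y hx hy v :=
    Subtype.ext (LieSuperModule.act_sbracket (L := BMS) a b x.1 y.1 hx hy v.1)

theorem coe_borelModule_parity {q : ℕ} {Y : Submodule ℂ X} (hY : IsStable {i | InBorel q i} Y)
    (hp : ∀ v ∈ Y, parity v ∈ Y) (v : Y) :
    letI := borelModule hY hp
    ((parity v : Y) : X) = parity (v : X) := by
  let := borelModule hY hp
  obtain ⟨v₀, h₀, v₁, h₁, rfl⟩ := exists_eq_add_parts v
  have e₀ : (v₀ : X) ∈ (part 0 : Submodule ℂ X) := h₀
  have e₁ : (v₁ : X) ∈ (part 1 : Submodule ℂ X) := h₁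
  simp [parity_of_mem h₀, parity_of_mem h₁, parity_of_mem e₀, parity_of_mem e₁]

/-- In a simple module, an inducing graded subspace is a simple module. -/
theorem IsInducing.isSimple {q t : ℕ} {Y : Submodule ℂ X} (H : IsInducing q t Y)
    (hp : ∀ v ∈ Y, parity v ∈ Y) (hX : IsSimpleSuperModule BMS X) (h0 : Y ≠ ⊥) :
    letI := borelModule H.stable hp
    IsSimpleSuperModule (borel q).toSubmodule Y := by
  let := borelModule H.stable hp
  refine ⟨Submodule.nontrivial_iff_ne_bot.2 h0, fun N hN => ?_⟩
  by_cases hN0 : N = ⊥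
  · exact Or.inl hN0
  refine Or.inr ?_
  have hle : N.map Y.subtype ≤ Y := by
    rintro _ ⟨v, _, rfl⟩
    exact v.2
  have hstab : IsStable {i | InBorel q i} (N.map Y.subtype) := by
    rintro i hi _ ⟨v, hv, rfl⟩
    exact ⟨_, hN.act_mem ⟨basis i, single_mem_borel hi⟩ v hv, rfl⟩
  have hpar : ∀ v ∈ N.map Y.subtype, parity v ∈ N.map Y.subtype := by
    rintro _ ⟨v, hv, rfl⟩
    refine ⟨parity v, ?_, coe_borelModule_parity H.stable hp v⟩
    obtain ⟨v₀, h₀, v₁, h₁, e₀, e₁, rfl⟩ := hN.graded v hv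
    rw [map_add, parity_of_mem e₀, parity_of_mem e₁]
    exact N.add_mem (N.smul_mem _ h₀) (N.smul_mem _ h₁)
  -- The `𝔤`-submodule generated by `N` is zero or all of `X`; in the second case intersecting with
  -- `Y` gives back `N`, so `N` is everything.
  rcases hX.eq_bot_or_eq_top _ (isSuperSubmodule_generated hstab hpar) with h | h
  · refine absurd ?_ hN0
    have h2 := le_bot_iff.1 ((le_generated q (N.map Y.subtype)).trans h.le)
    exact Submodule.map_injective_of_injective Y.subtype_injective 
      (h2.trans (Submodule.map_bot _).symm)
  · refine eq_top_iff.2 fun v _ => ?_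
    obtain ⟨w, hw, hwv⟩ := H.mem_of_mem_generated hle hstab v.2 (h ▸ Submodule.mem_top)
    rwa [← Subtype.ext hwv]

/-- A simple module is induced from every nonzero inducing graded subspace. -/
theorem IsInducing.nonempty_iso {q t : ℕ} {Y : Submodule ℂ X} (H : IsInducing q t Y)
    (hp : ∀ v ∈ Y, parity v ∈ Y) (hX : IsSimpleSuperModule BMS X) (h0 : Y ≠ ⊥) :
    letI := borelModule H.stable hp
    Nonempty (SuperModuleIso BMS X (IndQ q Y)) := by
  let := borelModule H.stable hp
  have hf (h : (borel q).toSubmodule) (v : Y) : Y.subtype (act h v) = act (h : BMS) (Y.subtype v) :=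
    rfl
  have hpf (v : Y) : Y.subtype (parity v) = parity (Y.subtype v) :=
    coe_borelModule_parity H.stable hp v
  refine ⟨Ind.isoOfBijective Y.subtype hf hpf ⟨?_, ?_⟩⟩
  · rw [injective_iff_map_eq_zero]
    have hstab : IsStable {i | InBorel q i} (LinearMap.range (Ind.incl (borel q) Y)) := by
      rintro i hi _ ⟨v, rfl⟩
      exact ⟨_, Ind.incl_act (borel q) Y ⟨basis i, single_mem_borel hi⟩ v⟩
    -- The induced module is spanned by ordered monomials over the image of `Y`, and these monomials
    -- are independent in `X`. The canonical map `Y → Ind Y` need not be known to be injective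
    -- beforehand.
    have htop : generated q (LinearMap.range (Ind.incl (borel q) Y)) = ⊤ :=
      Ind.eq_top_of_incl_mem (borel q) Y (fun v => le_generated q _ ⟨v, rfl⟩)
        (fun x u hu => act_mem_generated hstab x hu)
    intro z hz
    refine H.injOn_generated hstab (Ind.lift Y.subtype hf) (fun a u => Ind.lift_act _ hf _ _)
      ?_ ?_ z (htop ▸ Submodule.mem_top) hz
    · rintro _ ⟨v, rfl⟩
      rw [Ind.lift_incl]
      exact v.2
    · rintro _ ⟨v, rfl⟩ hv
      rw [Ind.lift_incl] at hv
      rw [show v = 0 from Subtype.ext hv, map_zero]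
  · rw [← LinearMap.range_eq_top]
    refine (hX.eq_bot_or_eq_top _ (op_isSuperSubmodule ?_ ?_)).resolve_left fun h => h0 ?_
    · rintro i _ ⟨z, rfl⟩
      exact ⟨act (basis i) z, Ind.lift_act _ hf _ _⟩
    · rintro _ ⟨z, rfl⟩
      exact ⟨_, Ind.lift_parityOp _ hf hpf z⟩
    · refine eq_bot_iff.2 fun v hv => ?_
      rw [← h]
      exact ⟨Ind.incl (borel q) Y ⟨v, hv⟩, Ind.lift_incl _ hf _⟩

/-! ## Existence of an inducing subspace -/

/-- The vectors killed by `M_i`, `Q_{i-1/2}` for `i > t` and by `L_j` for `j > t + q`. -/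
noncomputable def topSpace (X : Type*) [AddCommGroup X] [Module ℂ X] [LieSuperModule BMS X]
    (q t : ℕ) : Submodule ℂ X where
  carrier := {w | (∀ i : ℤ, (t : ℤ) < i → op X (.M i) w = 0) ∧
    (∀ i : ℤ, (t : ℤ) < i → op X (.Q i) w = 0) ∧
    (∀ i : ℤ, (t : ℤ) + q < i → op X (.L i) w = 0)}
  zero_mem' := by simp
  add_mem' := by
    rintro a b ⟨h1, h2, h3⟩ ⟨h1', h2', h3'⟩
    exact ⟨fun i hi => by rw [map_add, h1 i hi, h1' i hi, add_zero],
      fun i hi => by rw [map_add, h2 i hi, h2' i hi, add_zero],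
      fun i hi => by rw [map_add, h3 i hi, h3' i hi, add_zero]⟩
  smul_mem' := by
    rintro r a ⟨h1, h2, h3⟩
    exact ⟨fun i hi => by rw [map_smul, h1 i hi, smul_zero],
      fun i hi => by rw [map_smul, h2 i hi, smul_zero],
      fun i hi => by rw [map_smul, h3 i hi, smul_zero]⟩

variable {q t : ℕ}

theorem parity_mem_topSpace {v : X} (hv : v ∈ topSpace X q t) : parity v ∈ topSpace X q t := by
  have h (i : BMSIndex) (hi : op X i v = 0) : op X i (parity v) = 0 := by
    have h1 := parity_op i v
    rw [hi, map_zero] at h1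
    exact (smul_eq_zero.1 h1.symm).resolve_left (pow_ne_zero _ (by simp))
  exact ⟨fun i hi => h _ (hv.1 i hi), fun i hi => h _ (hv.2.1 i hi), fun i hi => h _ (hv.2.2 i hi)⟩

/-- Brackets with the annihilating operators stay among them. The threshold `t + q` for the `L`'s is
what `M_i` with `i ≥ -q` requires: `k > t + q` gives `k + i > t`. The degrees involved are such that
no central term occurs. -/
theorem isStable_topSpace : IsStable {i | InBorel q i} (topSpace X q t) := by
  rintro s hs w ⟨hM, hQ, hL⟩
  cases s with
  | L i =>
    replace hs : 0 ≤ i := hs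
    refine ⟨fun k hk => ?_, fun k hk => ?_, fun k hk => ?_⟩
    · rw [op_M_L, hM k hk, hM (i + k) (by omega), if_neg (by omega)]
      simp
    · have h := op_L_Q i k w
      rw [hQ k hk, hQ (i + k) (by omega)] at h
      simpa using h.symm
    · rw [op_L_L, hL k hk, hL (k + i) (by omega), if_neg (by omega)]
      simp
  | M i =>
    replace hs : -(q : ℤ) ≤ i := hs
    refine ⟨fun k hk => ?_, fun k hk => ?_, fun k hk => ?_⟩
    · rw [op_M_M, hM k hk, map_zero]
    · rw [← op_M_Q, hQ k hk, map_zero]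
    · rw [op_L_M, hL k hk, hM (k + i) (by omega), if_neg (by omega)]
      simp
  | Q i =>
    replace hs : 1 ≤ i := hs
    refine ⟨fun k hk => ?_, fun k hk => ?_, fun k hk => ?_⟩
    · rw [op_M_Q, hM k hk, map_zero]
    · rw [op_Q_Q, hQ k hk, hM (k + i - 1) (by omega), if_neg (by omega)]
      simp
    · rw [op_L_Q, hL k hk, hQ (k + i) (by omega)]
      simp
  | c₁ => exact ⟨fun k hk => by rw [← op_c₁_op, hM k hk, map_zero],
      fun k hk => by rw [← op_c₁_op, hQ k hk, map_zero],
      fun k hk => by rw [← op_c₁_op, hL k hk, map_zero]⟩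
  | c₂ => exact ⟨fun k hk => by rw [← op_c₂_op, hM k hk, map_zero],
      fun k hk => by rw [← op_c₂_op, hQ k hk, map_zero],
      fun k hk => by rw [← op_c₂_op, hL k hk, map_zero]⟩

/-- A vector of `topSpace X q (t + 1)` killed by `M_{t+1}` yields a nonzero vector of
`topSpace X (q + 1) t`. -/
theorem topSpace_ne_bot_of_kill {v : X} (hv : v ∈ topSpace X q (t + 1))
    (h : op X (.M ((t + 1 : ℕ) : ℤ)) v = 0) (h0 : v ≠ 0) : topSpace X (q + 1) t ≠ ⊥ := by
  have step {w : X} (hw : w ∈ topSpace X q (t + 1)) (hM : op X (.M (t + 1)) w = 0)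
      (hQ : op X (.Q (t + 1)) w = 0) : w ∈ topSpace X (q + 1) t := by
    obtain ⟨h1, h2, h3⟩ := hw
    -- The condition on the `L`'s is unchanged because `(t + 1) + q = t + (q + 1)`; this is why `q`
    -- grows as `t` drops.
    refine ⟨fun i hi => ?_, fun i hi => ?_, fun i hi => h3 i (by push_cast at hi ⊢; omega)⟩
    · rcases eq_or_ne i (t + 1) with rfl | hne
      · exact hM
      · exact h1 i (by push_cast; omega)
    · rcases eq_or_ne i (t + 1) with rfl | hne
      · exact hQ
      · exact h2 i (by push_cast; omega)
  rw [Nat.cast_succ] at h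
  rw [Submodule.ne_bot_iff]
  by_cases hq : op X (.Q (t + 1)) v = 0
  · exact ⟨v, step hv h hq, h0⟩
  -- If `Q_{t+1/2} v ≠ 0`, this vector replaces `v`. It is killed by `Q_{t+1/2}`, whose square is
  -- `M_{2t+1}`: for `t = 0` this is the `M_{t+1}` that kills `v`, and for `t > 0` one has `2t + 1 >
  -- t + 1`.
  · refine ⟨_, step (isStable_topSpace (.Q (t + 1)) (by simp [InBorel]) v hv) ?_ ?_, hq⟩
    · rw [op_M_Q, h, map_zero]
    · rw [op_Q_Q_self]
      rcases Nat.eq_zero_or_pos t with rfl | ht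
      · simpa using h
      · exact hv.1 _ (by push_cast; omega)

theorem exists_topSpace_ne_bot (hX : IsSmooth X) [Nontrivial X] : ∃ t, ∃ q, topSpace X q t ≠ ⊥ := by
  obtain ⟨w, hw⟩ := exists_ne (0 : X)
  obtain ⟨D, hD⟩ := hX w
  refine ⟨D.toNat, 0, (Submodule.ne_bot_iff _).2 ⟨w, ⟨fun i hi => ?_, fun i hi => ?_,
    fun i hi => ?_⟩, hw⟩⟩
  · exact (hD i (by omega)).2.1
  · exact (hD i (by omega)).2.2
  · exact (hD i (by push_cast at hi; omega)).1

/-- Minimality of `t` provides the injectivity of `M_t` when `t > 0`. It is required over all `p`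
together, because lowering `t` changes `q` into `q + 1`. -/
theorem isInducing_topSpace
    (hinj : ∀ n : ℤ, n ≠ 0 → Function.Injective fun w : X =>
      act (M 0 + ((1 / 24 : ℂ) * ((n : ℂ) ^ 2 - 1)) • c₂) w)
    (hmin : ∀ s < t, ∀ p, topSpace X p s = ⊥) : IsInducing q t (topSpace X q t) where
  M_mem k hk := isStable_topSpace (.M k) (by simp only [Set.mem_ofPred_eq, InBorel]; omega)
  c₂_mem := isStable_topSpace .c₂ trivial
  M_kill k hk v hv := hv.1 k hk
  inj_pos ht v hv h := by
    obtain ⟨s, rfl⟩ := Nat.exists_eq_succ_of_ne_zero ht.ne'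
    by_contra h0
    exact topSpace_ne_bot_of_kill hv h h0 (hmin s (Nat.lt_succ_self s) (q + 1))
  inj_zero _ n hn v _ h := by
    refine hinj n hn ?_
    simp only [map_add, map_smul, LinearMap.add_apply, LinearMap.smul_apply, map_zero]
    exact h
  stable := isStable_topSpace
  Q_kill k hk v hv := hv.2.1 k hk
  L_kill k hk v hv := hv.2.2 k hk

end

end BMS

/-! ### The equivalence -/

theorem proposition4p3 (z₁ z₂ : ℂ) (W : Type u) [AddCommGroup W] [Module ℂ W]
    [LieSuperModule BMS W]
    (hW : BMS.IsSmoothOfCentralCharge W z₁ z₂)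
    (hsimple : IsSimpleSuperModule BMS W)
    (hinj : ∀ n : ℤ, n ≠ 0 → Function.Injective fun w : W =>
      LieSuperModule.act (BMS.M 0 + ((1 / 24 : ℂ) * ((n : ℂ) ^ 2 - 1)) • BMS.c₂) w) :
    List.TFAE [
      ∃ l : ℕ, 0 < l ∧ ∀ i : ℤ, (l : ℤ) ≤ i →
        IsLocallyFiniteOp (LieSuperModule.act (V := W) (BMS.L i)) ∧
        IsLocallyFiniteOp (LieSuperModule.act (V := W) (BMS.M i)) ∧
        IsLocallyFiniteOp (LieSuperModule.act (V := W) (BMS.Q i)),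
      ∃ l : ℕ, 0 < l ∧ ∀ i : ℤ, (l : ℤ) ≤ i →
        IsLocallyNilpotentOp (LieSuperModule.act (V := W) (BMS.L i)) ∧
        IsLocallyNilpotentOp (LieSuperModule.act (V := W) (BMS.M i)) ∧
        IsLocallyNilpotentOp (LieSuperModule.act (V := W) (BMS.Q i)),
      ∃ (q : ℕ) (V : Type u) (_ : AddCommGroup V) (_ : Module ℂ V)
        (_ : LieSuperModule (BMS.borel q).toSubmodule V),
        BMS.BorelCentralCharge q V z₁ z₂ ∧
        IsSimpleSuperModule (BMS.borel q).toSubmodule V ∧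
        (∃ t : ℕ, BMS.ConditionA q V t ∧ BMS.ConditionB q V t) ∧
        Nonempty (SuperModuleIso BMS W (BMS.IndQ q V))] := by
  have h2 := BMS.exists_isLocallyNilpotentOp hW.smooth hsimple
  tfae_have 2 → 1 := by
    rintro ⟨l, hl, h⟩
    exact ⟨l, hl, fun i hi => ⟨(h i hi).1.isLocallyFiniteOp, (h i hi).2.1.isLocallyFiniteOp,
      (h i hi).2.2.isLocallyFiniteOp⟩⟩
  tfae_have 1 → 3 := by
    intro _
    have := hsimple.nontrivial
    have hex := BMS.exists_topSpace_ne_bot hW.smooth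
    classical
    obtain ⟨q, hq⟩ := Nat.find_spec hex
    -- The least `t` over all `q` at once; `q` is then any value for which the space is nonzero.
    set t := Nat.find hex
    have H : BMS.IsInducing q t (BMS.topSpace W q t) :=
        BMS.isInducing_topSpace hinj fun s hs p => by
      by_contra h
      exact Nat.find_min hex hs ⟨p, h⟩
    have hp : ∀ v ∈ BMS.topSpace W q t, parity v ∈ BMS.topSpace W q t :=
      fun v => BMS.parity_mem_topSpace
    let := BMS.borelModule H.stable hp
    refine ⟨q, BMS.topSpace W q t, inferInstance, inferInstance, BMS.borelModule H.stable hp,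
      ⟨fun v => Subtype.ext (hW.act_c₁ v), fun v => Subtype.ext (hW.act_c₂ v)⟩,
      H.isSimple hp hsimple hq, ⟨t, ⟨fun ht => ?_, fun ht n hn v w hvw => ?_⟩,
      fun i hi v => Subtype.ext (H.M_kill i hi v v.2),
      fun i hi v => Subtype.ext (H.L_kill i hi v v.2)⟩, H.nonempty_iso hp hsimple hq⟩
    · refine (injective_iff_map_eq_zero (LieSuperModule.act (BMS.borelM q t (by omega)) :
        BMS.topSpace W q t →ₗ[ℂ] BMS.topSpace W q t)).2 fun v hv => ?_
      exact Subtype.ext (H.inj_pos ht v v.2 (congrArg Subtype.val hv))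
    · exact Subtype.ext (hinj n hn (congrArg Subtype.val hvw))
  tfae_have 3 → 2 := fun _ => h2
  tfae_finish
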